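/- Let $X_1, X_2, \dots$ be independent, identically distributed real random variables whose cumulative distribution function $F$ is absolutely continuous, with probability density function $f$. Let $VJ(X) = \operatorname{Var}\left(-\tfrac12 f(X)\right) \in [0,\infty]$ be the varextropy of $X \sim F$; when $\int f^3 < \infty$ it equals $\tfrac14 \int f^3(x)\,dx - \tfrac14 \left[\int f^2(x)\,dx\right]^2$, and it is $+\infty$ when $f(X)$ is not square integrable, that is, when $\int f^3 = \infty$. For a sample size $n$ and a positive integer $m \le n/2$, let $X_{1:n} \le \dots \le X_{n:n}$ be the order statistics of $X_1, \dots, X_n$, put $X_{j:n} = X_{n:n}$ for $j > n$ and $X_{j:n} = X_{1:n}$ for $j < 1$, and let $$\widehat{\Delta} = \frac{1}{4n} \sum_{i=1}^{n} \left(\frac{2m/n}{X_{i+m:n} - X_{i-m:n}}\right)^{2} - \frac14 \left[\frac1n \sum_{i=1}^{n} \frac{2m/n}{X_{i+m:n} - X_{i-m:n}}\right]^2 .$$ Then $\widehat{\Delta}$ converges in probability to $VJ(X)$ as $n \to \infty$, $m \to \infty$ and $m/n \to 0$: for every sequence $m = m(n)$ with $m(n) \to \infty$ and $m(n)/n \to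 0$, if $VJ(X) < \infty$ then $P(|\widehat{\Delta} - VJ(X)| \ge \varepsilon) \to 0$ for every $\varepsilon > 0$, and if $VJ(X) = \infty$ then $P(\widehat{\Delta} \le K) \to 0$ for every real $K$. -/

import Mathlib

open MeasureTheory ProbabilityTheory Filter Topology
open scoped ENNReal

noncomputable section

/-- The varextropy `VJ(X) = Var(-f(X)/2)` of a real random variable `X` with probability density
function `f`, as an element of `[0, ∞]`; it is `∞` exactly when `f(X)` is not square integrable. -/
def varextropy {Ω : Type*} [MeasurableSpace Ω] (X : Ω → ℝ) (μ : Measure Ω) : ℝ≥0∞ :=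
  evariance (fun ω => -(1 / 2 : ℝ) * (pdf X μ volume (X ω)).toReal) μ

/-- The order statistics of a sample, in nondecreasing order. Indices are counted from `0`:
`orderStat x i` is the order statistic usually written `x_{i+1:n}`. -/
def orderStat {n : ℕ} (x : Fin n → ℝ) : Fin n → ℝ :=
  x ∘ Tuple.sort x

/-- The ratio `(2m/n) / (x_{i+m:n} - x_{i-m:n})`, where an index above the largest one is replaced
by the largest one and an index below the smallest one by the smallest one (with indices counted
from `0`, the truncated subtraction `i - m` does the latter). -/
def spacingRatio {n : ℕ} (m : ℕ) (x : Fin n → ℝ) (i : Fin n) : ℝ :=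
  (2 * (m : ℝ) / (n : ℝ)) /
    (orderStat x ⟨min ((i : ℕ) + m) (n - 1), by have := i.isLt; omega⟩
      - orderStat x ⟨(i : ℕ) - m, by have := i.isLt; omega⟩)

/-- The `m`-spacing estimator of the varextropy from a sample of size `n`. -/
def varextropyEstimator {n : ℕ} (m : ℕ) (x : Fin n → ℝ) : ℝ :=
  1 / (4 * (n : ℝ)) * ∑ i, spacingRatio m x i ^ 2
    - 1 / 4 * (1 / (n : ℝ) * ∑ i, spacingRatio m x i) ^ 2

end

/-! Sorting only permutes the sample, so the estimator is a quarter of the empirical variance of the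
spacing ratios `S_j` attached to the sample points `X_j`. The idea is that `S_j` estimates `f(X_j)`,
and that the empirical variance of `f(X_j)` obeys the law of large numbers.

Fix `X_j = a`. The spacing at `a` is governed by how many of the other points lie in short intervals
near `a`. Chebyshev's inequality and differentiability of the cdf at `a` give `S_j → f(a)` in
probability for `P`-almost every `a`. To upgrade this to mean square, a Chernoff bound shows that
`S_j` has tail at most `(8eM(a)/s)^3`, where `M` is the maximal function of `P`; hence its second
moment is `O(M(a)^2)`. The maximal inequality gives `∫ M^3 ≤ 60 ∫ f^3`, so `M^2` is `P`-integrable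
when `∫ f^3 < ∞`. Dominated convergence (`tendsto_lintegral_spacingAt_sub`) then makes the average
of `(S_j - f(X_j))^2` tend to zero in mean, and `abs_sampleVariance_sub_le` transfers this to the
variances.

If `∫ f^3 = ∞`, cut at a level `T`. Truncation decreases the empirical variance, truncated errors
tend to zero without any moment condition, and the variance of `min (f(X)) T` can be made
arbitrarily large (`exists_le_variance_min`). -/

/-! ### Ranks and counts seen from one sample point. -/

/-- The number of sample points that lie in `I`. -/
noncomputable def sampleCount {n : ℕ} (I : Set ℝ) (z : Fin n → ℝ) : ℕ :=
  open Classical in (Finset.univ.filter fun k => z k ∈ I).card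

/-- The spacing ratio at the rank of the sample point `x j`. -/
noncomputable def spacingAt {n : ℕ} (m : ℕ) (x : Fin n → ℝ) (j : Fin n) : ℝ :=
  spacingRatio m x ((Tuple.sort x).symm j)

lemma orderStat_monotone {n : ℕ} (x : Fin n → ℝ) : Monotone (orderStat x) :=
  Tuple.monotone_sort x

lemma orderStat_sort_symm {n : ℕ} (x : Fin n → ℝ) (j : Fin n) :
    orderStat x ((Tuple.sort x).symm j) = x j := by
  simp [orderStat]

/-- The inverse sorting permutation maps the sample points other than the `j`-th bijectively onto
the ranks other than `i`. -/
lemma sampleCount_eq_card_orderStat {n : ℕ} (I : Set ℝ) (j : Fin (n + 1)) (a : ℝ)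
    (z : Fin n → ℝ) (x : Fin (n + 1) → ℝ) (hx : x = Fin.insertNth j a z) (i : Fin (n + 1))
    (hi : i = (Tuple.sort x).symm j) (S : Finset (Fin (n + 1)))
    (hS : ∀ l, l ∈ S ↔ l ≠ i ∧ orderStat x l ∈ I) :
    sampleCount I z = S.card := by
  classical
  unfold sampleCount
  refine Finset.card_bij (fun k _ => (Tuple.sort x).symm (j.succAbove k)) ?_ ?_ ?_
  · intro k hk
    simp only [Finset.mem_filter, Finset.mem_univ, true_and] at hk
    rw [hS, orderStat_sort_symm, hi]
    refine ⟨fun h => ?_, ?_⟩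
    · exact Fin.succAbove_ne j k ((Tuple.sort x).symm.injective h)
    · rw [hx, Fin.insertNth_apply_succAbove]; exact hk
  · intro k _ k' _ h
    exact Fin.succAbove_right_injective ((Tuple.sort x).symm.injective h)
  · intro l hl
    obtain ⟨hl1, hl2⟩ := (hS l).1 hl
    have hne : Tuple.sort x l ≠ j := by
      intro h
      apply hl1
      rw [hi, ← h, Equiv.symm_apply_apply]
    obtain ⟨k, hk⟩ := Fin.exists_succAbove_eq hne
    refine ⟨k, ?_, ?_⟩
    · simp only [Finset.mem_filter, Finset.mem_univ, true_and]
      have : orderStat x l = z k := by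
        rw [orderStat, Function.comp_apply, ← hk, hx, Fin.insertNth_apply_succAbove]
      rwa [← this]
    · simp [hk]

/-! ### Order statistics `m` ranks away versus counts in intervals. -/

section Bracket

variable {n m : ℕ} {j : Fin (n + 1)} {a b : ℝ} {z : Fin n → ℝ} {x : Fin (n + 1) → ℝ}
  {i : Fin (n + 1)}

lemma orderStat_sort_symm_insertNth (hx : x = Fin.insertNth j a z)
    (hi : i = (Tuple.sort x).symm j) : orderStat x i = a := by
  rw [hi, orderStat_sort_symm, hx]; simp

/-- Excluding `a` from the interval makes ties harmless: every point counted has rank strictly above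
`i`. If the order statistic of rank `i + m` exceeded `b`, only `m - 1` ranks would be left for these
points. -/
lemma orderStat_le_of_le_sampleCount (hx : x = Fin.insertNth j a z)
    (hi : i = (Tuple.sort x).symm j) (hm0 : 0 < m) (hm : m ≤ sampleCount (Set.Ioc a b) z) :
    ∃ h : (i : ℕ) + m < n + 1, orderStat x ⟨i + m, h⟩ ≤ b := by
  classical
  have hai := orderStat_sort_symm_insertNth hx hi
  rw [sampleCount_eq_card_orderStat (Set.Ioc a b) j a z x hx i hi
    (Finset.univ.filter fun l => l ≠ i ∧ orderStat x l ∈ Set.Ioc a b) (by simp)] at hm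
  have hgt : ∀ l, a < orderStat x l → i < l := fun l hl =>
    (orderStat_monotone x).reflect_lt (by rwa [hai])
  have hlt : (i : ℕ) + m < n + 1 := by
    have := hm.trans (Finset.card_le_card (t := Finset.Ioi i) fun l hl => by
      simp only [Finset.mem_filter, Finset.mem_univ, true_and, Set.mem_Ioc] at hl
      exact Finset.mem_Ioi.2 (hgt l hl.2.1))
    rw [Fin.card_Ioi] at this
    omega
  refine ⟨hlt, ?_⟩
  by_contra hb
  have := hm.trans (Finset.card_le_card (t := Finset.Ioo i ⟨i + m, hlt⟩) fun l hl => by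
    simp only [Finset.mem_filter, Finset.mem_univ, true_and, Set.mem_Ioc] at hl
    refine Finset.mem_Ioo.2 ⟨hgt l hl.2.1, ?_⟩
    exact (orderStat_monotone x).reflect_lt (hl.2.2.trans_lt (not_le.1 hb)))
  rw [Fin.card_Ioo] at this
  simp only at this
  omega

lemma le_orderStat_of_le_sampleCount (hx : x = Fin.insertNth j a z)
    (hi : i = (Tuple.sort x).symm j) (hm0 : 0 < m) (hm : m ≤ sampleCount (Set.Ico b a) z) :
    ∃ h : (i : ℕ) - m < n + 1, m ≤ (i : ℕ) ∧ b ≤ orderStat x ⟨i - m, h⟩ := by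
  classical
  have hai := orderStat_sort_symm_insertNth hx hi
  rw [sampleCount_eq_card_orderStat (Set.Ico b a) j a z x hx i hi
    (Finset.univ.filter fun l => l ≠ i ∧ orderStat x l ∈ Set.Ico b a) (by simp)] at hm
  have hgt : ∀ l, orderStat x l < a → l < i := fun l hl =>
    (orderStat_monotone x).reflect_lt (by rwa [hai])
  have hle : m ≤ (i : ℕ) := by
    have := hm.trans (Finset.card_le_card (t := Finset.Iio i) fun l hl => by
      simp only [Finset.mem_filter, Finset.mem_univ, true_and, Set.mem_Ico] at hl
      exact Finset.mem_Iio.2 (hgt l hl.2.2))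
    rwa [Fin.card_Iio] at this
  have hlt : (i : ℕ) - m < n + 1 := by have := i.isLt; omega
  refine ⟨hlt, hle, ?_⟩
  by_contra hb
  have := hm.trans (Finset.card_le_card (t := Finset.Ioo ⟨i - m, hlt⟩ i) fun l hl => by
    simp only [Finset.mem_filter, Finset.mem_univ, true_and, Set.mem_Ico] at hl
    refine Finset.mem_Ioo.2 ⟨?_, hgt l hl.2.2⟩
    exact (orderStat_monotone x).reflect_lt ((not_le.1 hb).trans_le hl.2.1))
  rw [Fin.card_Ioo] at this
  simp only at this
  omega

/-- A converse, with `a` included because the next `m` order statistics may tie with it. -/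
lemma le_sampleCount_of_orderStat_le (hx : x = Fin.insertNth j a z)
    (hi : i = (Tuple.sort x).symm j) (h : (i : ℕ) + m < n + 1) (hb : orderStat x ⟨i + m, h⟩ ≤ b) :
    m ≤ sampleCount (Set.Icc a b) z := by
  classical
  have hai := orderStat_sort_symm_insertNth hx hi
  rw [sampleCount_eq_card_orderStat (Set.Icc a b) j a z x hx i hi
    (Finset.univ.filter fun l => l ≠ i ∧ orderStat x l ∈ Set.Icc a b) (by simp)]
  have := Finset.card_le_card (s := Finset.Ioc i ⟨i + m, h⟩)
    (t := Finset.univ.filter fun l => l ≠ i ∧ orderStat x l ∈ Set.Icc a b) fun l hl => by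
      rw [Finset.mem_Ioc] at hl
      simp only [Finset.mem_filter, Finset.mem_univ, true_and, Set.mem_Icc]
      exact ⟨hl.1.ne', hai ▸ orderStat_monotone x hl.1.le, (orderStat_monotone x hl.2).trans hb⟩
  rw [Fin.card_Ioc] at this
  simp only at this
  omega

lemma le_sampleCount_of_le_orderStat (hx : x = Fin.insertNth j a z)
    (hi : i = (Tuple.sort x).symm j) (h : (i : ℕ) - m < n + 1) (hm : m ≤ (i : ℕ))
    (hb : b ≤ orderStat x ⟨i - m, h⟩) :
    m ≤ sampleCount (Set.Icc b a) z := by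
  classical
  have hai := orderStat_sort_symm_insertNth hx hi
  rw [sampleCount_eq_card_orderStat (Set.Icc b a) j a z x hx i hi
    (Finset.univ.filter fun l => l ≠ i ∧ orderStat x l ∈ Set.Icc b a) (by simp)]
  have := Finset.card_le_card (s := Finset.Ico ⟨i - m, h⟩ i)
    (t := Finset.univ.filter fun l => l ≠ i ∧ orderStat x l ∈ Set.Icc b a) fun l hl => by
      rw [Finset.mem_Ico] at hl
      simp only [Finset.mem_filter, Finset.mem_univ, true_and, Set.mem_Icc]
      exact ⟨hl.2.ne, hb.trans (orderStat_monotone x hl.1), hai ▸ orderStat_monotone x hl.2.le⟩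
  rw [Fin.card_Ico] at this
  simp only at this
  omega

end Bracket

lemma sampleCount_mono {n : ℕ} {I J : Set ℝ} (h : I ⊆ J) (z : Fin n → ℝ) :
    sampleCount I z ≤ sampleCount J z := by
  classical
  exact Finset.card_le_card fun k hk => by
    simp only [Finset.mem_filter, Finset.mem_univ, true_and] at hk ⊢
    exact h hk

lemma spacingRatio_nonneg {n : ℕ} (m : ℕ) (x : Fin n → ℝ) (i : Fin n) : 0 ≤ spacingRatio m x i := by
  refine div_nonneg (by positivity) (sub_nonneg.2 (orderStat_monotone x ?_))
  have := i.isLt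
  rw [Fin.mk_le_mk]
  omega

lemma spacingAt_nonneg {n : ℕ} (m : ℕ) (x : Fin n → ℝ) (j : Fin n) : 0 ≤ spacingAt m x j :=
  spacingRatio_nonneg _ _ _

/-- The four counts place each of the two order statistics at distance between `t'` and `t` from
`a`. The first two also keep both indices inside the sample, so no clamping occurs. -/
lemma spacingAt_mem_Icc {n m : ℕ} (hm0 : 0 < m) (j : Fin (n + 1)) {a t t' : ℝ} (ht' : 0 < t')
    (z : Fin n → ℝ)
    (h1 : m ≤ sampleCount (Set.Ioc a (a + t)) z) (h2 : m ≤ sampleCount (Set.Ico (a - t) a) z)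
    (h3 : sampleCount (Set.Icc a (a + t')) z < m) (h4 : sampleCount (Set.Icc (a - t') a) z < m) :
    (m : ℝ) / (n + 1 : ℕ) / t ≤ spacingAt m (Fin.insertNth j a z : Fin (n + 1) → ℝ) j ∧
      spacingAt m (Fin.insertNth j a z : Fin (n + 1) → ℝ) j ≤ (m : ℝ) / (n + 1 : ℕ) / t' := by
  set x : Fin (n + 1) → ℝ := Fin.insertNth j a z with hx
  set i := (Tuple.sort x).symm j with hi
  obtain ⟨hlt, hu⟩ := orderStat_le_of_le_sampleCount hx hi hm0 h1
  obtain ⟨hlt', hle, hl⟩ := le_orderStat_of_le_sampleCount hx hi hm0 h2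
  have hu' : a + t' < orderStat x ⟨i + m, hlt⟩ :=
    not_le.1 fun h => absurd (le_sampleCount_of_orderStat_le hx hi hlt h) (not_le.2 h3)
  have hl' : orderStat x ⟨i - m, hlt'⟩ < a - t' :=
    not_le.1 fun h => absurd (le_sampleCount_of_le_orderStat hx hi hlt' hle h) (not_le.2 h4)
  have key : spacingAt m x j = 2 * ((m : ℝ) / (n + 1 : ℕ)) /
      (orderStat x ⟨i + m, hlt⟩ - orderStat x ⟨i - m, hlt'⟩) := by
    have hmin : min ((i : ℕ) + m) (n + 1 - 1) = i + m := by omega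
    simp only [spacingAt, spacingRatio, ← hi, hmin, mul_div_assoc]
  have hc : (0 : ℝ) ≤ (m : ℝ) / (n + 1 : ℕ) := by positivity
  have e (s : ℝ) : (m : ℝ) / (n + 1 : ℕ) / s = 2 * ((m : ℝ) / (n + 1 : ℕ)) / (2 * s) := by
    rw [mul_div_mul_left _ _ two_ne_zero]
  rw [key, e, e]
  constructor
  · apply div_le_div_of_nonneg_left (by positivity) <;> linarith
  · apply div_le_div_of_nonneg_left (by positivity) <;> linarith

/-- A large ratio means a short spacing, and every unclamped side of it carries `m` further points
within that distance of `a`. -/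
lemma le_sampleCount_of_lt_spacingAt {n m : ℕ} (hmn : 2 * m ≤ n + 1) (j : Fin (n + 1))
    {a s : ℝ} (hs : 0 < s) (z : Fin n → ℝ)
    (h : s < spacingAt m (Fin.insertNth j a z : Fin (n + 1) → ℝ) j) :
    m ≤ sampleCount (Metric.closedBall a (2 * m / (n + 1 : ℕ) / s)) z := by
  set x : Fin (n + 1) → ℝ := Fin.insertNth j a z with hx
  set i := (Tuple.sort x).symm j with hi
  set d := 2 * (m : ℝ) / (n + 1 : ℕ) / s with hd
  have hin := i.isLt
  have hai := orderStat_sort_symm_insertNth hx hi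
  have hU : a ≤ orderStat x ⟨min (i + m) (n + 1 - 1), by omega⟩ := by
    refine hai.symm.trans_le (orderStat_monotone x ?_)
    rw [Fin.le_def]; simp only; omega
  have hL : orderStat x ⟨i - m, by omega⟩ ≤ a := by
    refine (orderStat_monotone x ?_).trans_eq hai
    rw [Fin.le_def]; simp only; omega
  have hlt : orderStat x ⟨min (i + m) (n + 1 - 1), by omega⟩ - orderStat x ⟨i - m, by omega⟩
      < d := by
    simp only [spacingAt, spacingRatio, ← hi] at h
    have hpos : 0 < orderStat x ⟨min (i + m) (n + 1 - 1), by omega⟩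
        - orderStat x ⟨i - m, by omega⟩ := by
      -- A spacing of length zero gives ratio `0` by the convention on division, which cannot exceed
      -- `s`.
      rcases (sub_nonneg.2 (hL.trans hU)).eq_or_lt with h0 | h0
      · rw [← h0, div_zero] at h
        exact absurd h (not_lt.2 hs.le)
      · exact h0
    rw [lt_div_iff₀ hpos] at h
    rw [hd, lt_div_iff₀ hs]
    linarith
  rw [Real.closedBall_eq_Icc]
  have hd0 : 0 ≤ d := by positivity
  -- When the upper index is clamped, `2 * m ≤ n + 1` forces `m ≤ i`, so the lower side is intact.
  by_cases hc : (i : ℕ) + m < n + 1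
  · have hmin : min ((i : ℕ) + m) (n + 1 - 1) = i + m := by omega
    simp only [hmin] at hlt
    refine (le_sampleCount_of_orderStat_le hx hi hc (b := a + d) (by linarith)).trans
      (sampleCount_mono (Set.Icc_subset_Icc (by linarith) le_rfl) z)
  · refine (le_sampleCount_of_le_orderStat hx hi (b := a - d) (by omega) (by omega)
      (by linarith)).trans (sampleCount_mono (Set.Icc_subset_Icc le_rfl (by linarith)) z)

lemma measurableSet_sort_eq {n : ℕ} (σ : Equiv.Perm (Fin n)) :
    MeasurableSet {x : Fin n → ℝ | Tuple.sort x = σ} := by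
  simp_rw [eq_comm (b := σ), Tuple.eq_sort_iff, Monotone, Function.comp_apply]
  measurability

/-- On each of the finitely many sets where the sorting permutation is constant, the ratio is a
fixed measurable expression in the coordinates. -/
lemma measurable_spacingAt {n : ℕ} (m : ℕ) (j : Fin n) :
    Measurable fun x : Fin n → ℝ => spacingAt m x j := by
  have : (fun x : Fin n → ℝ => spacingAt m x j) = fun x => ∑ σ : Equiv.Perm (Fin n),
      {x : Fin n → ℝ | Tuple.sort x = σ}.indicator (fun x => (2 * (m : ℝ) / (n : ℝ)) /
        (x (σ ⟨min ((σ.symm j : ℕ) + m) (n - 1), by have := (σ.symm j).isLt; omega⟩)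
          - x (σ ⟨(σ.symm j : ℕ) - m, by have := (σ.symm j).isLt; omega⟩))) x := by
    ext x
    rw [Finset.sum_eq_single (Tuple.sort x)]
    · rw [Set.indicator_of_mem (by simp)]
      rfl
    · intro σ _ hσ
      exact Set.indicator_of_notMem (fun h => hσ h.symm) _
    · simp
  rw [this]
  refine Finset.measurable_sum _ fun σ _ => Measurable.indicator ?_ (measurableSet_sort_eq σ)
  fun_prop

/-! ### Concentration of binomial counts. -/

section Count

variable {P : Measure ℝ} [IsProbabilityMeasure P]

lemma sampleCount_eq_sum {n : ℕ} (I : Set ℝ) (z : Fin n → ℝ) :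
    (sampleCount I z : ℝ) = ∑ k, I.indicator (fun _ => (1 : ℝ)) (z k) := by
  classical
  simp [sampleCount, Set.indicator_apply]

/-- Chebyshev's inequality, a binomial variance being at most its mean. -/
lemma measure_le_abs_sampleCount_sub_le {n : ℕ} {I : Set ℝ} (hI : MeasurableSet I) {c : ℝ}
    (hc : 0 < c) :
    Measure.pi (fun _ : Fin n => P) {z | c ≤ |(sampleCount I z : ℝ) - n * P.real I|}
      ≤ ENNReal.ofReal (n * P.real I / c ^ 2) := by
  set g : ℝ → ℝ := I.indicator fun _ => 1 with hg
  have hgm : Measurable g := measurable_const.indicator hI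
  have hgL : MemLp g 2 P := memLp_indicator_const 2 hI 1 (Or.inr (measure_ne_top _ _))
  have hcomp (k : Fin n) : MemLp (fun z : Fin n → ℝ => g (z k)) 2 (Measure.pi fun _ => P) :=
    hgL.comp_measurePreserving (measurePreserving_eval (fun _ : Fin n => P) k)
  have hE : ∫ z, (∑ k : Fin n, fun z : Fin n → ℝ => g (z k)) z ∂(Measure.pi fun _ => P)
      = n * P.real I := by
    simp only [Finset.sum_apply]
    rw [integral_finsetSum _ fun k _ => (hcomp k).integrable (by norm_num)]
    have (k : Fin n) : ∫ z, g (z k) ∂(Measure.pi fun _ : Fin n => P) = P.real I := by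
      rw [integral_comp_eval (μ := fun _ : Fin n => P) hgm.aestronglyMeasurable]
      exact integral_indicator_one hI
    simp [this]
  have hV : Var[∑ k : Fin n, fun z : Fin n → ℝ => g (z k); Measure.pi fun _ => P]
      ≤ n * P.real I := by
    rw [variance_sum_pi (μ := fun _ : Fin n => P) (X := fun _ => g) fun _ => hgL]
    have : Var[g; P] ≤ P.real I := by
      refine (variance_le_expectation_sq hgm.aestronglyMeasurable).trans_eq ?_
      have : g ^ 2 = I.indicator 1 := by
        ext x; by_cases hx : x ∈ I <;> simp [hg, hx]
      rw [this, integral_indicator_one hI]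
    simpa using mul_le_mul_of_nonneg_left this n.cast_nonneg
  have hL : MemLp (∑ k : Fin n, fun z : Fin n → ℝ => g (z k)) 2 (Measure.pi fun _ => P) :=
    memLp_finsetSum' _ fun k _ => hcomp k
  have h := meas_ge_le_variance_div_sq hL hc
  rw [hE] at h
  simp only [sampleCount_eq_sum]
  simp only [Finset.sum_apply] at h
  exact h.trans (ENNReal.ofReal_le_ofReal (by gcongr))

/-- Chernoff bound: Markov's inequality for `c ^ count` with `c = m / r`. By independence its mean
is `(1 + (c - 1) p)^n ≤ exp ((c - 1) r) ≤ exp m`, to be divided by `c ^ m`. -/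
lemma measure_le_sampleCount_le {n m : ℕ} {I : Set ℝ} (hI : MeasurableSet I) {r : ℝ}
    (hr : 0 < r) (hrm : r ≤ m) (hp : n * P.real I ≤ r) :
    Measure.pi (fun _ : Fin n => P) {z | m ≤ sampleCount I z}
      ≤ ENNReal.ofReal ((Real.exp 1 * r / m) ^ m) := by
  classical
  have hm : (0 : ℝ) < m := hr.trans_le hrm
  set c : ℝ := m / r with hc
  have hc1 : 1 ≤ c := (one_le_div hr).2 hrm
  set g : ℝ → ℝ := fun x => 1 + (c - 1) * I.indicator (fun _ => 1) x with hg
  have hprod (z : Fin n → ℝ) : ∏ k, g (z k) = c ^ sampleCount I z := by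
    have (k : Fin n) : g (z k) = if z k ∈ I then c else 1 := by
      by_cases hx : z k ∈ I <;> simp [hg, hx]
    simp_rw [this]
    rw [Finset.prod_ite]
    simp only [Finset.prod_const, one_pow, mul_one, sampleCount]
  have hgi : Integrable g P := by
    refine (integrable_const _).add (Integrable.const_mul ?_ _)
    exact (integrable_const (1 : ℝ)).indicator hI
  have hEg : ∫ x, g x ∂P = 1 + (c - 1) * P.real I := by
    rw [hg, integral_add (integrable_const _)
      (((integrable_const (1 : ℝ)).indicator hI).const_mul _), integral_const_mul]
    rw [show I.indicator (fun _ => (1 : ℝ)) = I.indicator 1 from rfl, integral_indicator_one hI]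
    simp
  have hint : Integrable (fun z : Fin n → ℝ => ∏ k, g (z k)) (Measure.pi fun _ => P) :=
    Integrable.fintype_prod fun _ => hgi
  have hnn : 0 ≤ᵐ[Measure.pi fun _ : Fin n => P] fun z : Fin n → ℝ => ∏ k, g (z k) :=
    ae_of_all _ fun z => by simp only [hprod]; positivity
  have hmk := mul_meas_ge_le_integral_of_nonneg hnn hint (c ^ m)
  rw [integral_fintype_prod_eq_pow, Fintype.card_fin, hEg] at hmk
  have hsub : {z : Fin n → ℝ | m ≤ sampleCount I z} ⊆ {z | c ^ m ≤ ∏ k, g (z k)} := by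
    intro z hz
    simp only [Set.mem_ofPred_eq, hprod] at hz ⊢
    exact pow_le_pow_right₀ hc1 hz
  have hexp : (1 + (c - 1) * P.real I) ^ n ≤ Real.exp m := by
    have h1 : 1 + (c - 1) * P.real I ≤ Real.exp ((c - 1) * P.real I) := by
      linarith [Real.add_one_le_exp ((c - 1) * P.real I)]
    have h0 : 0 ≤ 1 + (c - 1) * P.real I := by
      have : 0 ≤ (c - 1) * P.real I := mul_nonneg (by linarith) measureReal_nonneg
      linarith
    refine (pow_le_pow_left₀ h0 h1 n).trans ?_
    rw [← Real.exp_nat_mul, Real.exp_le_exp]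
    calc n * ((c - 1) * P.real I) = (c - 1) * (n * P.real I) := by ring
      _ ≤ (c - 1) * r := mul_le_mul_of_nonneg_left hp (by linarith)
      _ = m - r := by rw [hc]; field_simp
      _ ≤ m := by linarith
  have hfin : (Measure.pi fun _ : Fin n => P).real {z | c ^ m ≤ ∏ k, g (z k)}
      ≤ (Real.exp 1 * r / m) ^ m := by
    have hcm : 0 < c ^ m := by positivity
    rw [← mul_le_mul_iff_right₀ hcm]
    refine (hmk.trans hexp).trans_eq ?_
    rw [← mul_pow, hc, ← Real.exp_one_pow]
    congr 1
    field_simp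
  refine (measure_mono hsub).trans ?_
  rw [← ofReal_measureReal]
  exact ENNReal.ofReal_le_ofReal hfin

lemma tendsto_measure_abs_sampleCount_sub {m : ℕ → ℕ} (hm : Tendsto m atTop atTop)
    {I : ℕ → Set ℝ} (hI : ∀ n, MeasurableSet (I n)) {c δ : ℝ} (hδ : 0 < δ)
    (h : Tendsto (fun n : ℕ => n * P.real (I n) / m n) atTop (𝓝 c)) :
    Tendsto (fun n => Measure.pi (fun _ : Fin n => P)
      {z | δ * m n ≤ |(sampleCount (I n) z : ℝ) - n * P.real (I n)|}) atTop (𝓝 0) := by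
  have hm' : Tendsto (fun n => (m n : ℝ)) atTop atTop := tendsto_natCast_atTop_atTop.comp hm
  have hlim : Tendsto (fun n : ℕ => ENNReal.ofReal
      (n * P.real (I n) / m n * (δ ^ 2 * m n)⁻¹)) atTop (𝓝 0) := by
    have := h.mul (tendsto_inv_atTop_zero.comp (hm'.const_mul_atTop (pow_pos hδ 2)))
    rw [mul_zero] at this
    simpa using ENNReal.tendsto_ofReal this
  refine tendsto_of_tendsto_of_tendsto_of_le_of_le' tendsto_const_nhds hlim
    (Eventually.of_forall fun _ => zero_le) ?_
  filter_upwards [hm'.eventually_gt_atTop 0] with n hn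
  refine (measure_le_abs_sampleCount_sub_le (hI n) (mul_pos hδ hn)).trans_eq ?_
  congr 1
  field_simp

lemma tendsto_measure_le_sampleCount {m : ℕ → ℕ} (hm : Tendsto m atTop atTop)
    {I : ℕ → Set ℝ} (hI : ∀ n, MeasurableSet (I n)) {c : ℝ} (hc : c < 1)
    (h : Tendsto (fun n : ℕ => n * P.real (I n) / m n) atTop (𝓝 c)) :
    Tendsto (fun n => Measure.pi (fun _ : Fin n => P) {z | m n ≤ sampleCount (I n) z})
      atTop (𝓝 0) := by
  refine tendsto_of_tendsto_of_tendsto_of_le_of_le' tendsto_const_nhds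
    (tendsto_measure_abs_sampleCount_sub hm hI (δ := (1 - c) / 2) (by linarith) h)
    (Eventually.of_forall fun _ => zero_le) ?_
  have hm' : Tendsto (fun n => (m n : ℝ)) atTop atTop := tendsto_natCast_atTop_atTop.comp hm
  filter_upwards [hm'.eventually_gt_atTop 0,
    h.eventually_lt_const (show c < c + (1 - c) / 2 by linarith)] with n hn hlt
  refine measure_mono fun z hz => ?_
  simp only [Set.mem_ofPred_eq] at hz ⊢
  have hz' : (m n : ℝ) ≤ sampleCount (I n) z := by exact_mod_cast hz
  rw [div_lt_iff₀ hn] at hlt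
  refine le_trans ?_ (le_abs_self _)
  nlinarith

lemma tendsto_measure_sampleCount_lt {m : ℕ → ℕ} (hm : Tendsto m atTop atTop)
    {I : ℕ → Set ℝ} (hI : ∀ n, MeasurableSet (I n)) {c : ℝ} (hc : 1 < c)
    (h : Tendsto (fun n : ℕ => n * P.real (I n) / m n) atTop (𝓝 c)) :
    Tendsto (fun n => Measure.pi (fun _ : Fin n => P) {z | sampleCount (I n) z < m n})
      atTop (𝓝 0) := by
  refine tendsto_of_tendsto_of_tendsto_of_le_of_le' tendsto_const_nhds
    (tendsto_measure_abs_sampleCount_sub hm hI (δ := (c - 1) / 2) (by linarith) h)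
    (Eventually.of_forall fun _ => zero_le) ?_
  have hm' : Tendsto (fun n => (m n : ℝ)) atTop atTop := tendsto_natCast_atTop_atTop.comp hm
  filter_upwards [hm'.eventually_gt_atTop 0,
    h.eventually_const_lt (show c - (c - 1) / 2 < c by linarith)] with n hn hlt
  refine measure_mono fun z hz => ?_
  simp only [Set.mem_ofPred_eq] at hz ⊢
  have hz' : (sampleCount (I n) z : ℝ) < m n := by exact_mod_cast hz
  rw [lt_div_iff₀ hn] at hlt
  rw [abs_sub_comm]
  refine le_trans ?_ (le_abs_self _)
  nlinarith

end Count

/-! ### The spacing ratio at a fixed point: limit and tail. -/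

section Pointwise

variable {P : Measure ℝ} [IsProbabilityMeasure P]

lemma measureReal_Ioc_eq_cdf_sub {a b : ℝ} (hab : a ≤ b) :
    P.real (Set.Ioc a b) = cdf P b - cdf P a := by
  conv_lhs => rw [measureReal_def, ← measure_cdf P]
  rw [StieltjesFunction.measure_Ioc,
    ENNReal.toReal_ofReal (sub_nonneg.2 (monotone_cdf P hab))]

/-- This is `u` times a difference quotient of the cdf, up to the factor `n / (n + 1)`: there are
`n` other points in a sample of size `n + 1`. -/
lemma tendsto_cdf_sub_div {P : Measure ℝ} {m : ℕ → ℕ} (hm : Tendsto m atTop atTop)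
    (hmn : Tendsto (fun n : ℕ => (m n : ℝ) / (n + 1 : ℕ)) atTop (𝓝 0)) {a f : ℝ}
    (hf : HasDerivAt (cdf P) f a) {u : ℝ} (hu : u ≠ 0) :
    Tendsto (fun n : ℕ => n * (cdf P (a + (m n : ℝ) / (n + 1 : ℕ) * u) - cdf P a) / m n)
      atTop (𝓝 (u * f)) := by
  have hpos : ∀ᶠ n in atTop, (m n : ℝ) ≠ 0 :=
    (hm.eventually_gt_atTop 0).mono fun n hn => by exact_mod_cast hn.ne'
  have hto : Tendsto (fun n : ℕ => a + (m n : ℝ) / (n + 1 : ℕ) * u) atTop (𝓝[≠] a) := by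
    refine tendsto_nhdsWithin_iff.2 ⟨?_, ?_⟩
    · simpa using (hmn.mul_const u).const_add a
    · filter_upwards [hpos] with n hn
      have : (m n : ℝ) / (n + 1 : ℕ) * u ≠ 0 :=
        mul_ne_zero (div_ne_zero hn (by positivity)) hu
      simpa using this
  have h1 := (hf.tendsto_slope.comp hto).const_mul u
  have h2 : Tendsto (fun n : ℕ => (n : ℝ) / (n + 1 : ℕ)) atTop (𝓝 1) := by
    simpa using tendsto_natCast_div_add_atTop (1 : ℝ)
  have h3 := h2.mul h1
  rw [one_mul] at h3
  refine h3.congr' ?_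
  filter_upwards [hpos] with n hn
  simp only [Function.comp_apply, slope_def_field, add_sub_cancel_left]
  field_simp

/-- Ratios near `v < f` and `f + s > f` correspond to interval lengths whose expected counts are
about `m f / v > m` and `m f / (f + s) < m`. Concentration decides all four counts required by
`spacingAt_mem_Icc`. -/
lemma tendsto_measure_abs_spacingAt_sub [NullSingletonClass P] {m : ℕ → ℕ} (hm : Tendsto m atTop atTop)
    (hmn : Tendsto (fun n : ℕ => (m n : ℝ) / (n + 1 : ℕ)) atTop (𝓝 0)) {a f : ℝ}
    (hf : HasDerivAt (cdf P) f a) (hf0 : 0 < f) (j : ∀ n, Fin (n + 1)) {s : ℝ} (hs : 0 < s) :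
    Tendsto (fun n => Measure.pi (fun _ : Fin n => P)
      {z | s < |spacingAt (m n) (Fin.insertNth (j n) a z : Fin (n + 1) → ℝ) (j n) - f|})
      atTop (𝓝 0) := by
  -- The term `f / 2` keeps the lower target positive when `s ≥ f`.
  set v : ℝ := max (f - s) (f / 2) with hv
  have hv0 : 0 < v := lt_max_of_lt_right (by linarith)
  have hvf : v < f := max_lt (by linarith) (by linarith)
  set u : ℝ := 1 / v with hu
  set u' : ℝ := 1 / (f + s) with hu'
  have hu0 : 0 < u := by positivity
  have hu0' : 0 < u' := by positivity
  have huf : 1 < u * f := by rw [hu, one_div_mul_eq_div, one_lt_div hv0]; exact hvf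
  have huf' : u' * f < 1 := by
    rw [hu', one_div_mul_eq_div, div_lt_one (by positivity)]; linarith
  set t : ℕ → ℝ := fun n => (m n : ℝ) / (n + 1 : ℕ) * u with ht
  set t' : ℕ → ℝ := fun n => (m n : ℝ) / (n + 1 : ℕ) * u' with ht'
  have ht0 (n : ℕ) : 0 ≤ t n := by positivity
  have ht0' (n : ℕ) : 0 ≤ t' n := by positivity
  have hright (w : ℝ) (hw : 0 < w) : Tendsto (fun n : ℕ => n * P.real (Set.Ioc a
      (a + (m n : ℝ) / (n + 1 : ℕ) * w)) / m n) atTop (𝓝 (w * f)) := by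
    refine (tendsto_cdf_sub_div hm hmn hf hw.ne').congr fun n => ?_
    rw [measureReal_Ioc_eq_cdf_sub (le_add_of_nonneg_right (by positivity))]
  have hleft (w : ℝ) (hw : 0 < w) : Tendsto (fun n : ℕ => n * P.real (Set.Ioc
      (a - (m n : ℝ) / (n + 1 : ℕ) * w) a) / m n) atTop (𝓝 (w * f)) := by
    have := (tendsto_cdf_sub_div hm hmn hf (neg_ne_zero.2 hw.ne')).neg
    rw [neg_mul, neg_neg] at this
    refine this.congr fun n => ?_
    rw [measureReal_Ioc_eq_cdf_sub (sub_le_self _ (by positivity)), mul_neg, ← sub_eq_add_neg]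
    ring
  have h1 := tendsto_measure_sampleCount_lt hm (I := fun n => Set.Ioc a (a + t n))
    (fun _ => measurableSet_Ioc) huf (hright u hu0)
  have h2 := tendsto_measure_sampleCount_lt hm (I := fun n => Set.Ico (a - t n) a)
    (fun _ => measurableSet_Ico) huf ((hleft u hu0).congr fun n => by
      rw [measureReal_congr (Ico_ae_eq_Ioc (μ := P))])
  have h3 := tendsto_measure_le_sampleCount hm (I := fun n => Set.Icc a (a + t' n))
    (fun _ => measurableSet_Icc) huf' ((hright u' hu0').congr fun n => by
      rw [measureReal_congr (Ioc_ae_eq_Icc (μ := P))])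
  have h4 := tendsto_measure_le_sampleCount hm (I := fun n => Set.Icc (a - t' n) a)
    (fun _ => measurableSet_Icc) huf' ((hleft u' hu0').congr fun n => by
      rw [measureReal_congr (Ioc_ae_eq_Icc (μ := P))])
  have hsum := ((h1.add h2).add h3).add h4
  simp only [add_zero] at hsum
  refine tendsto_of_tendsto_of_tendsto_of_le_of_le' tendsto_const_nhds hsum
    (Eventually.of_forall fun _ => zero_le) ?_
  filter_upwards [hm.eventually_gt_atTop 0] with n hn
  refine le_trans (measure_mono ?_) ((measure_union_le _ _).trans (add_le_add_left
    ((measure_union_le _ _).trans (add_le_add_left (measure_union_le _ _) _)) _))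
  intro z hz
  by_contra hcon
  simp only [Set.mem_union, Set.mem_ofPred_eq, not_or, not_lt, not_le] at hcon hz
  obtain ⟨⟨⟨c1, c2⟩, c3⟩, c4⟩ := hcon
  have hmn0 : (0 : ℝ) < (m n : ℝ) / (n + 1 : ℕ) :=
    div_pos (by exact_mod_cast hn) (by positivity)
  obtain ⟨b1, b2⟩ := spacingAt_mem_Icc hn (j n) (mul_pos hmn0 hu0') z c1 c2 c3 c4
  rw [ht, div_mul_cancel_left₀ hmn0.ne', hu, one_div, inv_inv] at b1
  rw [div_mul_cancel_left₀ hmn0.ne', hu', one_div, inv_inv] at b2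
  have : f - s ≤ v := le_max_left _ _
  exact absurd hz (not_lt.2 (abs_le.2 ⟨by linarith, by linarith⟩))

/-- The tail bound `min 1 (A / s) ^ 3`. -/
noncomputable def cubicTail (A s : ℝ) : ℝ≥0∞ :=
  if s ≤ A then 1 else ENNReal.ofReal ((A / s) ^ 3)

/-- The ball forced by a ratio above `s` has expected count at most `r = 8 m M / s`, so Chernoff
gives `(8 e M / s)^m`. Lowering the exponent to `3` makes the bound independent of `n` and still
leaves a finite second moment. -/
lemma measure_lt_spacingAt_le {n m : ℕ} (hm : 3 ≤ m) (hmn : 2 * m ≤ n + 1) (j : Fin (n + 1))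
    {a M : ℝ} (hM : 0 < M) (hball : ∀ d > 0, P.real (Metric.closedBall a d) ≤ 4 * d * M)
    {s : ℝ} (hs : 0 < s) :
    Measure.pi (fun _ : Fin n => P)
      {z | s < spacingAt m (Fin.insertNth j a z : Fin (n + 1) → ℝ) j}
      ≤ cubicTail (Real.exp 1 * 8 * M) s := by
  unfold cubicTail
  split_ifs with h
  · exact prob_le_one
  push Not at h
  have hm0 : (0 : ℝ) < m := by exact_mod_cast (by omega : 0 < m)
  have hr : 0 < 8 * m * M / s := by positivity
  have hratio : Real.exp 1 * 8 * M / s ≤ 1 := (div_le_one hs).2 h.le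
  have he : 1 ≤ Real.exp 1 := Real.one_le_exp zero_le_one
  refine (measure_mono fun z hz => le_sampleCount_of_lt_spacingAt hmn j hs z hz).trans
    ((measure_le_sampleCount_le (P := P) Metric.isClosed_closedBall.measurableSet hr ?_ ?_).trans
      (ENNReal.ofReal_le_ofReal ?_))
  · rw [div_le_iff₀ hs]
    nlinarith [mul_pos hm0 hM]
  · have hd : 0 < 2 * (m : ℝ) / (n + 1 : ℕ) / s := by positivity
    calc (n : ℝ) * P.real (Metric.closedBall a (2 * (m : ℝ) / (n + 1 : ℕ) / s))
        ≤ (n + 1 : ℕ) * (4 * (2 * (m : ℝ) / (n + 1 : ℕ) / s) * M) := by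
          gcongr
          · exact_mod_cast n.le_succ
          · exact hball _ hd
      _ = 8 * m * M / s := by field_simp; ring
  · have : Real.exp 1 * (8 * m * M / s) / m = Real.exp 1 * 8 * M / s := by field_simp
    rw [this]
    exact pow_le_pow_of_le_one (by positivity) hratio hm

lemma lintegral_cubicTail_le {A : ℝ} (hA : 0 < A) :
    ∫⁻ s in Set.Ioi 0, cubicTail A s * ENNReal.ofReal s ≤ ENNReal.ofReal (2 * A ^ 2) := by
  rw [← Set.Ioc_union_Ioi_eq_Ioi hA.le, lintegral_union measurableSet_Ioi
    (Set.disjoint_left.2 fun x hx hx' => not_lt.2 hx.2 hx')]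
  have h1 : ∫⁻ s in Set.Ioc 0 A, cubicTail A s * ENNReal.ofReal s ≤ ENNReal.ofReal (A ^ 2) := by
    calc ∫⁻ s in Set.Ioc 0 A, cubicTail A s * ENNReal.ofReal s
        ≤ ∫⁻ s in Set.Ioc 0 A, ENNReal.ofReal A := by
          refine setLIntegral_mono measurable_const fun s hs => ?_
          rw [cubicTail, if_pos hs.2, one_mul]
          exact ENNReal.ofReal_le_ofReal hs.2
      _ = ENNReal.ofReal (A ^ 2) := by
          rw [setLIntegral_const, Real.volume_Ioc, sub_zero, ← ENNReal.ofReal_mul hA.le, sq]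
  have h2 : ∫⁻ s in Set.Ioi A, cubicTail A s * ENNReal.ofReal s = ENNReal.ofReal (A ^ 2) := by
    have hint : IntegrableOn (fun s : ℝ => A ^ 3 * s ^ (-2 : ℝ)) (Set.Ioi A) :=
      (integrableOn_Ioi_rpow_of_lt (by norm_num) hA).const_mul _
    have hval : ∫ s in Set.Ioi A, A ^ 3 * s ^ (-2 : ℝ) = A ^ 2 := by
      rw [integral_const_mul, integral_Ioi_rpow_of_lt (by norm_num) hA]
      norm_num
      rw [Real.rpow_neg_one]
      field_simp
    rw [← hval, ofReal_integral_eq_lintegral_ofReal hint]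
    · refine setLIntegral_congr_fun measurableSet_Ioi fun s hs => ?_
      have hs0 : 0 < s := hA.trans hs
      rw [cubicTail, if_neg (not_le.2 hs), ← ENNReal.ofReal_mul (by positivity)]
      congr 1
      rw [Real.rpow_neg hs0.le, Real.rpow_two]
      field_simp
    · refine (ae_restrict_mem measurableSet_Ioi).mono fun s hs => ?_
      have hs0 : 0 < s := hA.trans hs
      simp only [Pi.zero_apply]
      positivity
  rw [two_mul, ENNReal.ofReal_add (by positivity) (by positivity)]
  exact add_le_add h1 h2.le

end Pointwise

/-! ### The maximal function of `P` and its third moment. -/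

section MaximalAverage

/-- The density of `P` with respect to Lebesgue measure, as a real-valued function. -/
noncomputable def realDensity (P : Measure ℝ) (x : ℝ) : ℝ := (P.rnDeriv volume x).toReal

lemma measurable_realDensity (P : Measure ℝ) : Measurable (realDensity P) :=
  (Measure.measurable_rnDeriv P volume).ennreal_toReal

lemma realDensity_nonneg (P : Measure ℝ) (x : ℝ) : 0 ≤ realDensity P x := ENNReal.toReal_nonneg

/-- The centred Hardy-Littlewood maximal function of `P` along rational radii. -/
noncomputable def maximalAverage (P : Measure ℝ) (x : ℝ) : ℝ≥0∞ :=
  ⨆ q : {q : ℚ // 0 < q}, P (Metric.closedBall x (q : ℝ)) / ENNReal.ofReal (2 * (q : ℝ))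

variable {P : Measure ℝ} [IsProbabilityMeasure P]

lemma ofReal_realDensity_ae : ∀ᵐ x, ENNReal.ofReal (realDensity P x) = P.rnDeriv volume x :=
  (Measure.rnDeriv_lt_top P volume).mono fun _ hx => ENNReal.ofReal_toReal hx.ne

lemma measurable_maximalAverage : Measurable (maximalAverage P) := by
  refine Measurable.iSup fun q => Measurable.div_const ?_ _
  have hs : MeasurableSet {p : ℝ × ℝ | dist p.2 p.1 ≤ (q : ℝ)} :=
    measurableSet_le (measurable_snd.dist measurable_fst) measurable_const
  exact measurable_measure_prodMk_left (ν := P) hs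

/-- Where the density is at most `s / 2`, the ball of length `2 d` carries mass at most `s d`. -/
lemma measure_closedBall_le_of_realDensity (hac : P ≪ volume) {s : ℝ} (x : ℝ) {d : ℝ} (hd : 0 ≤ d) :
    P (Metric.closedBall x d)
      ≤ P.restrict {y | s < 2 * realDensity P y} (Metric.closedBall x d)
        + ENNReal.ofReal (s * d) := by
  set E := {y | s < 2 * realDensity P y}
  have hE : MeasurableSet E :=
    measurableSet_lt measurable_const ((measurable_realDensity P).const_mul 2)
  have hB : MeasurableSet (Metric.closedBall x d) := Metric.isClosed_closedBall.measurableSet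
  rw [Measure.restrict_apply hB, ← measure_inter_add_sdiff (Metric.closedBall x d) hE]
  gcongr
  rw [← Measure.setLIntegral_rnDeriv hac]
  calc ∫⁻ y in Metric.closedBall x d \ E, P.rnDeriv volume y
      ≤ ∫⁻ y in Metric.closedBall x d \ E, ENNReal.ofReal (s / 2) := by
        refine setLIntegral_mono_ae measurable_const.aemeasurable ?_
        filter_upwards [ofReal_realDensity_ae (P := P)] with y hy hyE
        rw [← hy]
        refine ENNReal.ofReal_le_ofReal ?_
        have : ¬ s < 2 * realDensity P y := hyE.2
        linarith
    _ ≤ ENNReal.ofReal (s / 2) * volume (Metric.closedBall x d) := by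
        rw [setLIntegral_const]
        gcongr
        exact Set.sdiff_subset
    _ = ENNReal.ofReal (s * d) := by
        rw [Real.volume_closedBall, ← ENNReal.ofReal_mul' (by positivity)]
        congr 1
        ring

/-- Weak-type estimate by Vitali covering. A ball of radius `q` with average above `s` has mass
above `2 s q`; the low part of the density explains only `s q`, so the high part has at least `s q`.
Keeping only the high part is what allows integration to a strong bound. -/
lemma volume_lt_maximalAverage_le (hac : P ≪ volume) {s : ℝ} (hs : 0 < s) :
    volume {x | ENNReal.ofReal s < maximalAverage P x}
      ≤ ENNReal.ofReal (10 / s) * P {y | s < 2 * realDensity P y} := by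
  set E := {y | s < 2 * realDensity P y}
  set ν := P.restrict E with hν
  set T := {x | ENNReal.ofReal s < maximalAverage P x} with hT
  have hex (x : ℝ) : ∃ r : ℝ, x ∈ T → 0 < r ∧ ENNReal.ofReal (s * r) ≤
      ν (Metric.closedBall x r) := by
    by_cases hx : x ∈ T
    · obtain ⟨⟨q, hq⟩, hlt⟩ := lt_iSup_iff.1 (show ENNReal.ofReal s < maximalAverage P x from hx)
      have hq' : (0 : ℝ) < q := by exact_mod_cast hq
      refine ⟨q, fun _ => ⟨hq', ?_⟩⟩
      simp only at hlt
      rw [ENNReal.lt_div_iff_mul_lt (Or.inl (by simpa using hq')) (Or.inl ENNReal.ofReal_ne_top),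
        ← ENNReal.ofReal_mul hs.le] at hlt
      have h := hlt.le.trans (measure_closedBall_le_of_realDensity hac (s := s) x hq'.le)
      rw [show s * (2 * (q : ℝ)) = s * q + s * q by ring,
        ENNReal.ofReal_add (by positivity) (by positivity)] at h
      exact (ENNReal.add_le_add_iff_right ENNReal.ofReal_ne_top).1 h
    · exact ⟨0, fun h => absurd h hx⟩
  choose r hr using hex
  -- Vitali needs bounded radii; total mass at most one provides the bound.
  have hbound : ∀ a ∈ T, r a ≤ 1 / s := by
    intro a ha
    have h1 : ENNReal.ofReal (s * r a) ≤ ENNReal.ofReal 1 := by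
      rw [ENNReal.ofReal_one]
      exact (hr a ha).2.trans ((Measure.restrict_apply_le _ _).trans prob_le_one)
    have h2 := (ENNReal.ofReal_le_ofReal_iff zero_le_one).1 h1
    rw [le_div_iff₀ hs]
    linarith
  obtain ⟨u, huT, hdisj, hcov⟩ := Vitali.exists_disjoint_subfamily_covering_enlargement_closedBall
    T id r (1 / s) hbound 5 (by norm_num)
  have hucount : u.Countable := by
    refine hdisj.countable_of_nonempty_interior fun a ha => ?_
    exact ⟨a, Metric.ball_subset_interior_closedBall (Metric.mem_ball_self (hr a (huT ha)).1)⟩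
  have hsub : T ⊆ ⋃ b ∈ u, Metric.closedBall b (5 * r b) := by
    intro a ha
    obtain ⟨b, hb, hab⟩ := hcov a ha
    exact Set.mem_biUnion hb (hab (Metric.mem_closedBall_self (hr a ha).1.le))
  have := hucount.to_subtype
  calc volume T ≤ ∑' b : u, volume (Metric.closedBall (b : ℝ) (5 * r b)) :=
        (measure_mono hsub).trans (measure_biUnion_le _ hucount _)
    _ ≤ ∑' b : u, ENNReal.ofReal (10 / s) * ν (Metric.closedBall (b : ℝ) (r b)) := by
        refine ENNReal.tsum_le_tsum fun b => ?_
        have hb := hr b (huT b.2)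
        refine le_trans (le_of_eq ?_) (mul_le_mul_right hb.2 _)
        rw [Real.volume_closedBall, ← ENNReal.ofReal_mul (by positivity)]
        congr 1
        field_simp
        ring
    _ = ENNReal.ofReal (10 / s) * ν (⋃ b ∈ u, Metric.closedBall b (r b)) := by
        rw [ENNReal.tsum_mul_left]
        congr 1
        exact (measure_biUnion hucount hdisj
          fun b _ => Metric.isClosed_closedBall.measurableSet).symm
    _ ≤ ENNReal.ofReal (10 / s) * P E := by
        refine mul_le_mul_right ?_ _
        exact (measure_mono (Set.subset_univ _)).trans_eq (Measure.restrict_apply_univ E)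

lemma maximalAverage_lt_top_ae (hac : P ≪ volume) : ∀ᵐ x, maximalAverage P x < ∞ := by
  have hle (k : ℕ) : volume {x | ¬ maximalAverage P x < ∞} ≤ ENNReal.ofReal (10 / (k + 1 : ℝ)) := by
    have hk : (0 : ℝ) < k + 1 := by positivity
    calc volume {x | ¬ maximalAverage P x < ∞}
        ≤ volume {x | ENNReal.ofReal (k + 1) < maximalAverage P x} := by
          refine measure_mono fun x hx => ?_
          exact ENNReal.ofReal_lt_top.trans_le (not_lt.1 hx)
      _ ≤ _ := (volume_lt_maximalAverage_le hac hk).trans (mul_le_of_le_one_right' prob_le_one)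
  refine le_antisymm (ge_of_tendsto' (x := atTop) (f := fun k : ℕ => ENNReal.ofReal
    (10 / (k + 1 : ℝ))) ?_ hle) zero_le
  have : Tendsto (fun k : ℕ => 10 * (1 / ((k : ℝ) + 1))) atTop (𝓝 (10 * 0)) :=
    tendsto_one_div_add_atTop_nhds_zero_nat.const_mul 10
  simpa [div_eq_mul_inv] using ENNReal.tendsto_ofReal this

/-- Layer cake on both sides of the weak-type estimate. The constant is `3 * 10 / 2 = 15`, times `4`
from `(2 f)^2`. -/
lemma lintegral_maximalAverage_cube_le (hac : P ≪ volume) :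
    ∫⁻ x, ENNReal.ofReal ((maximalAverage P x).toReal ^ 3)
      ≤ 60 * ∫⁻ x, ENNReal.ofReal (realDensity P x ^ 2) ∂P := by
  have h1 := lintegral_rpow_eq_lintegral_meas_lt_mul (volume : Measure ℝ)
    (f := fun x => (maximalAverage P x).toReal) (ae_of_all _ fun _ => ENNReal.toReal_nonneg)
    measurable_maximalAverage.ennreal_toReal.aemeasurable (p := 3) (by norm_num)
  have h2 := lintegral_rpow_eq_lintegral_meas_lt_mul P (f := fun x => 2 * realDensity P x)
    (ae_of_all _ fun x => mul_nonneg zero_le_two (realDensity_nonneg P x))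
    ((measurable_realDensity P).const_mul 2).aemeasurable (p := 2) (by norm_num)
  have e3 (y : ℝ) : y ^ (3 : ℝ) = y ^ 3 := by exact_mod_cast Real.rpow_natCast y 3
  rw [show (3 : ℝ) - 1 = 2 by norm_num, ENNReal.ofReal_ofNat] at h1
  rw [show (2 : ℝ) - 1 = 1 by norm_num, ENNReal.ofReal_ofNat] at h2
  simp only [e3, Real.rpow_two, Real.rpow_one] at h1 h2
  have h4 : ∫⁻ x, ENNReal.ofReal ((2 * realDensity P x) ^ 2) ∂P
      = 4 * ∫⁻ x, ENNReal.ofReal (realDensity P x ^ 2) ∂P := by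
    rw [← lintegral_const_mul _ ((measurable_realDensity P).pow_const 2).ennreal_ofReal]
    refine lintegral_congr fun x => ?_
    rw [mul_pow, ENNReal.ofReal_mul (by positivity)]
    norm_num
  rw [h4] at h2
  rw [h1]
  calc 3 * ∫⁻ t in Set.Ioi 0, volume {x | t < (maximalAverage P x).toReal} * ENNReal.ofReal (t ^ 2)
      ≤ 3 * ∫⁻ t in Set.Ioi 0, 10 * (P {x | t < 2 * realDensity P x} * ENNReal.ofReal t) := by
        gcongr 3 * ?_
        refine setLIntegral_mono' measurableSet_Ioi fun t ht => ?_
        have ht' : 0 < t := ht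
        calc volume {x | t < (maximalAverage P x).toReal} * ENNReal.ofReal (t ^ 2)
            ≤ (ENNReal.ofReal (10 / t) * P {x | t < 2 * realDensity P x})
              * ENNReal.ofReal (t ^ 2) := by
              gcongr
              refine le_trans (measure_mono fun x hx => ?_) (volume_lt_maximalAverage_le hac ht')
              have hx' : t < (maximalAverage P x).toReal := hx
              exact (ENNReal.ofReal_lt_ofReal_iff_of_nonneg ht'.le).2 hx' |>.trans_le
                ENNReal.ofReal_toReal_le
          _ = (ENNReal.ofReal (10 / t) * ENNReal.ofReal (t ^ 2))
                * P {x | t < 2 * realDensity P x} := by ring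
          _ = (10 * ENNReal.ofReal t) * P {x | t < 2 * realDensity P x} := by
              rw [← ENNReal.ofReal_mul (by positivity),
                show 10 / t * t ^ 2 = 10 * t by field_simp, ENNReal.ofReal_mul (by norm_num)]
              norm_num
          _ = _ := by ring
    _ = 15 * (2 * ∫⁻ t in Set.Ioi 0, P {x | t < 2 * realDensity P x} * ENNReal.ofReal t) := by
        rw [lintegral_const_mul']
        · ring
        · norm_num
    _ = 60 * ∫⁻ x, ENNReal.ofReal (realDensity P x ^ 2) ∂P := by
        rw [← h2]; ring

/-- Pointwise `f M^2 ≤ M^3 + f^3`, and integrating `f^2` against `P` is integrating `f^3` against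
Lebesgue measure. -/
lemma lintegral_maximalAverage_sq_lt_top (hac : P ≪ volume)
    (h : ∫⁻ x, ENNReal.ofReal (realDensity P x ^ 2) ∂P < ∞) :
    ∫⁻ x, ENNReal.ofReal ((maximalAverage P x).toReal ^ 2) ∂P < ∞ := by
  have hMm : Measurable fun x => (maximalAverage P x).toReal :=
    measurable_maximalAverage.ennreal_toReal
  have hfm := measurable_realDensity P
  have hf3 : ∫⁻ x, ENNReal.ofReal (realDensity P x ^ 3)
      = ∫⁻ x, ENNReal.ofReal (realDensity P x ^ 2) ∂P := by
    rw [← lintegral_rnDeriv_mul hac (hfm.pow_const 2).ennreal_ofReal.aemeasurable]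
    refine lintegral_congr_ae ((ofReal_realDensity_ae (P := P)).mono fun x hx => ?_)
    simp only
    rw [← hx, ← ENNReal.ofReal_mul (realDensity_nonneg P x)]
    congr 1
    ring
  rw [← lintegral_rnDeriv_mul hac (hMm.pow_const 2).ennreal_ofReal.aemeasurable]
  calc ∫⁻ x, P.rnDeriv volume x * ENNReal.ofReal ((maximalAverage P x).toReal ^ 2)
      ≤ ∫⁻ x, (ENNReal.ofReal ((maximalAverage P x).toReal ^ 3)
        + ENNReal.ofReal (realDensity P x ^ 3)) := by
        refine lintegral_mono_ae ((ofReal_realDensity_ae (P := P)).mono fun x hx => ?_)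
        have h0 := realDensity_nonneg P x
        have h0' : 0 ≤ (maximalAverage P x).toReal := ENNReal.toReal_nonneg
        rw [← hx, ← ENNReal.ofReal_mul h0, ← ENNReal.ofReal_add (by positivity) (by positivity)]
        refine ENNReal.ofReal_le_ofReal ?_
        rcases le_total (realDensity P x) (maximalAverage P x).toReal with hl | hl
        · nlinarith [pow_nonneg h0 3, mul_le_mul_of_nonneg_right hl (sq_nonneg
            (maximalAverage P x).toReal)]
        · nlinarith [pow_nonneg h0' 3, mul_le_mul_of_nonneg_left (pow_le_pow_left₀ h0' hl 2) h0]
    _ = (∫⁻ x, ENNReal.ofReal ((maximalAverage P x).toReal ^ 3))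
        + ∫⁻ x, ENNReal.ofReal (realDensity P x ^ 2) ∂P := by
        rw [lintegral_add_left (hMm.pow_const 3).ennreal_ofReal, hf3]
    _ < ∞ := by
        refine ENNReal.add_lt_top.2 ⟨(lintegral_maximalAverage_cube_le hac).trans_lt ?_, h⟩
        exact ENNReal.mul_lt_top (by norm_num) h

/-- Passing to a rational radius between `d` and `2 d` costs the factor two. -/
lemma measureReal_closedBall_le_maximalAverage {x : ℝ} (hx : maximalAverage P x < ∞) {d : ℝ}
    (hd : 0 < d) :
    P.real (Metric.closedBall x d) ≤ 4 * d * (maximalAverage P x).toReal := by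
  obtain ⟨q, hq1, hq2⟩ := exists_rat_btwn (show d < 2 * d by linarith)
  have hq0 : (0 : ℝ) < q := hd.trans hq1
  have h : P (Metric.closedBall x q) / ENNReal.ofReal (2 * (q : ℝ)) ≤ maximalAverage P x :=
    le_iSup (fun q : {q : ℚ // 0 < q} =>
      P (Metric.closedBall x (q : ℝ)) / ENNReal.ofReal (2 * (q : ℝ))) ⟨q, by exact_mod_cast hq0⟩
  have h2 := ENNReal.toReal_mono hx.ne h
  rw [ENNReal.toReal_div, ENNReal.toReal_ofReal (by positivity), div_le_iff₀ (by positivity)] at h2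
  calc P.real (Metric.closedBall x d) ≤ P.real (Metric.closedBall x q) :=
        measureReal_mono (Metric.closedBall_subset_closedBall hq1.le)
    _ ≤ (maximalAverage P x).toReal * (2 * q) := h2
    _ ≤ 4 * d * (maximalAverage P x).toReal := by
        have h0 : 0 ≤ (maximalAverage P x).toReal := ENNReal.toReal_nonneg
        nlinarith

lemma maximalAverage_toReal_pos {x : ℝ} (hx : maximalAverage P x < ∞) :
    0 < (maximalAverage P x).toReal := by
  refine ENNReal.toReal_nonneg.lt_of_ne fun h => ?_
  have hz (k : ℕ) : P (Metric.closedBall x ((k : ℝ) + 1)) = 0 := by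
    have := measureReal_closedBall_le_maximalAverage hx (d := (k : ℝ) + 1) (by positivity)
    rw [← h, mul_zero] at this
    exact (measureReal_eq_zero_iff).1 (le_antisymm this measureReal_nonneg)
  have huniv : P Set.univ = 0 := by
    refine measure_mono_null (fun y _ => ?_) (measure_iUnion_null hz)
    obtain ⟨k, hk⟩ := exists_nat_ge (dist y x)
    exact Set.mem_iUnion.2 ⟨k, Metric.mem_closedBall.2 (by linarith)⟩
  simp at huniv

end MaximalAverage

/-! ### Mean-square convergence of the spacing ratios. -/

section SecondMoment

lemma lintegral_sq_eq_lintegral_tail {α : Type*} [MeasurableSpace α] (ν : Measure α)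
    {h : α → ℝ} (h0 : ∀ x, 0 ≤ h x) (hm : Measurable h) :
    ∫⁻ x, ENNReal.ofReal (h x ^ 2) ∂ν
      = 2 * ∫⁻ s in Set.Ioi 0, ν {x | s < h x} * ENNReal.ofReal s := by
  have := lintegral_rpow_eq_lintegral_meas_lt_mul ν (ae_of_all _ h0) hm.aemeasurable (p := 2)
    (by norm_num)
  rw [show (2 : ℝ) - 1 = 1 by norm_num, ENNReal.ofReal_ofNat] at this
  simpa only [Real.rpow_two, Real.rpow_one] using this

/-- The probability spaces vary with `n`, so dominated convergence is applied to the tail functions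
on the half-line, through the layer-cake formula. -/
lemma tendsto_lintegral_sq_of_tail {α : ℕ → Type*} [∀ n, MeasurableSpace (α n)]
    (ν : ∀ n, Measure (α n)) {h : ∀ n, α n → ℝ} (h0 : ∀ n x, 0 ≤ h n x)
    (hm : ∀ n, Measurable (h n)) {b : ℝ → ℝ≥0∞}
    (hb : ∀ᶠ n in atTop, ∀ s > 0, ν n {x | s < h n x} ≤ b s)
    (hint : ∫⁻ s in Set.Ioi 0, b s * ENNReal.ofReal s ≠ ∞)
    (hlim : ∀ s > 0, Tendsto (fun n => ν n {x | s < h n x}) atTop (𝓝 0)) :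
    Tendsto (fun n => ∫⁻ x, ENNReal.ofReal (h n x ^ 2) ∂ν n) atTop (𝓝 0) := by
  simp_rw [fun n => lintegral_sq_eq_lintegral_tail (ν n) (h0 n) (hm n)]
  have key : Tendsto (fun n => ∫⁻ s in Set.Ioi 0, ν n {x | s < h n x} * ENNReal.ofReal s) atTop
      (𝓝 (∫⁻ s in Set.Ioi (0 : ℝ), 0)) := by
    refine tendsto_lintegral_filter_of_dominated_convergence _ (Eventually.of_forall fun n => ?_)
      (hb.mono fun n hn => ?_) hint ?_
    · refine Measurable.mul (Antitone.measurable fun s t hst => ?_) ENNReal.measurable_ofReal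
      exact measure_mono fun x hx => hst.trans_lt hx
    · exact (ae_restrict_mem measurableSet_Ioi).mono fun s hs => mul_le_mul_left (hn s hs) _
    · refine (ae_restrict_mem measurableSet_Ioi).mono fun s hs => ?_
      simpa using ENNReal.Tendsto.mul_const (hlim s hs) (Or.inr ENNReal.ofReal_ne_top)
  simpa using ENNReal.Tendsto.const_mul key (Or.inr (by norm_num))

lemma setLIntegral_indicator_Iio_mul_le (c : ℝ) :
    ∫⁻ s in Set.Ioi 0, (Set.Iio c).indicator (1 : ℝ → ℝ≥0∞) s * ENNReal.ofReal s
      ≤ ENNReal.ofReal c * ENNReal.ofReal c := by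
  calc ∫⁻ s in Set.Ioi 0, (Set.Iio c).indicator (1 : ℝ → ℝ≥0∞) s * ENNReal.ofReal s
      ≤ ∫⁻ s in Set.Ioi 0, (Set.Iio c).indicator (fun _ => ENNReal.ofReal c) s := by
        refine lintegral_mono fun s => ?_
        by_cases hs : s ∈ Set.Iio c
        · simp only [Set.indicator_of_mem hs, Pi.one_apply, one_mul]
          exact ENNReal.ofReal_le_ofReal (le_of_lt hs)
        · simp [Set.indicator_of_notMem hs]
    _ = ENNReal.ofReal c * ENNReal.ofReal c := by
        rw [lintegral_indicator measurableSet_Iio, setLIntegral_const,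
          Measure.restrict_apply measurableSet_Iio, Set.Iio_inter_Ioi, Real.volume_Ioo, sub_zero]

variable {P : Measure ℝ} [IsProbabilityMeasure P]

/-- Dominated convergence twice: in the tail level `s` for fixed `a`, then in `a` with dominating
function `2 B`. -/
lemma tendsto_lintegral_lintegral_sq_of_tail {h : ∀ n : ℕ, ℝ → (Fin n → ℝ) → ℝ}
    (h0 : ∀ n a z, 0 ≤ h n a z) (hm : ∀ n, Measurable (Function.uncurry (h n)))
    {b : ℝ → ℝ → ℝ≥0∞} {B : ℝ → ℝ≥0∞}
    (hb : ∀ᶠ n in atTop, ∀ᵐ a ∂P, ∀ s > 0,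
      Measure.pi (fun _ : Fin n => P) {z | s < h n a z} ≤ b a s)
    (hbB : ∀ᵐ a ∂P, ∫⁻ s in Set.Ioi 0, b a s * ENNReal.ofReal s ≤ B a)
    (hB : ∀ᵐ a ∂P, B a ≠ ∞) (hint : ∫⁻ a, B a ∂P ≠ ∞)
    (hlim : ∀ᵐ a ∂P, ∀ s > 0, Tendsto (fun n => Measure.pi (fun _ : Fin n => P)
      {z | s < h n a z}) atTop (𝓝 0)) :
    Tendsto (fun n => ∫⁻ a, ∫⁻ z, ENNReal.ofReal (h n a z ^ 2)
      ∂(Measure.pi fun _ : Fin n => P) ∂P) atTop (𝓝 0) := by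
  have hma (n : ℕ) (a : ℝ) : Measurable (h n a) := (hm n).of_uncurry_left
  have key : Tendsto (fun n => ∫⁻ a, ∫⁻ z, ENNReal.ofReal (h n a z ^ 2)
      ∂(Measure.pi fun _ : Fin n => P) ∂P) atTop (𝓝 (∫⁻ _, 0 ∂P)) := by
    refine tendsto_lintegral_filter_of_dominated_convergence (fun a => 2 * B a)
      (Eventually.of_forall fun n => ?_) (hb.mono fun n hn => ?_) ?_ ?_
    · exact Measurable.lintegral_prod_right' (f := fun p : ℝ × (Fin n → ℝ) =>
        ENNReal.ofReal (h n p.1 p.2 ^ 2)) ((hm n).pow_const 2).ennreal_ofReal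
    · filter_upwards [hn, hbB] with a ha haB
      rw [lintegral_sq_eq_lintegral_tail _ (h0 n a) (hma n a)]
      gcongr
      exact (setLIntegral_mono' measurableSet_Ioi fun s hs => mul_le_mul_left (ha s hs) _).trans haB
    · rw [lintegral_const_mul' _ _ (by norm_num)]
      exact ENNReal.mul_ne_top (by norm_num) hint
    · obtain ⟨N, hN⟩ := eventually_atTop.1 hb
      have hall : ∀ᵐ a ∂P, ∀ n ≥ N, ∀ s > 0,
          Measure.pi (fun _ : Fin n => P) {z | s < h n a z} ≤ b a s :=
        ae_all_iff.2 fun n => ae_all_iff.2 fun hn => hN n hn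
      filter_upwards [hall, hbB, hB, hlim] with a ha haB haB' halim
      exact tendsto_lintegral_sq_of_tail (fun n => Measure.pi fun _ : Fin n => P)
        (fun n => h0 n a) (fun n => hma n a) (eventually_atTop.2 ⟨N, ha⟩)
        (haB.trans_lt (lt_top_iff_ne_top.2 haB')).ne halim
  simpa using key

lemma measurable_insertNth {n : ℕ} (j : Fin (n + 1)) :
    Measurable fun p : ℝ × (Fin n → ℝ) => (Fin.insertNth j p.1 p.2 : Fin (n + 1) → ℝ) :=
  (MeasurableEquiv.piFinSuccAbove (fun _ : Fin (n + 1) => ℝ) j).symm.measurable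

lemma measurable_spacingAt_sub {P : Measure ℝ} {n : ℕ} (m : ℕ) (j : Fin (n + 1)) :
    Measurable fun p : ℝ × (Fin n → ℝ) =>
      spacingAt m (Fin.insertNth j p.1 p.2 : Fin (n + 1) → ℝ) j - realDensity P p.1 :=
  ((measurable_spacingAt m j).comp (measurable_insertNth j)).sub
    ((measurable_realDensity P).comp measurable_fst)

/-- Lebesgue differentiation, together with the fact that `P` does not charge the zero set of its
density. -/
lemma hasDerivAt_cdf_ae (hac : P ≪ volume) :
    ∀ᵐ x ∂P, HasDerivAt (cdf P) (realDensity P x) x ∧ 0 < realDensity P x := by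
  have h1 := (cdf P).ae_hasDerivAt
  rw [measure_cdf] at h1
  filter_upwards [hac.ae_le h1, Measure.rnDeriv_pos hac,
    hac.ae_le (Measure.rnDeriv_lt_top P volume)] with x hx hx0 hx1
  exact ⟨hx, ENNReal.toReal_pos hx0.ne' hx1.ne⟩

lemma tendsto_measure_abs_spacingAt_sub_ae (hac : P ≪ volume) {m : ℕ → ℕ}
    (hm : Tendsto m atTop atTop)
    (hmn : Tendsto (fun n : ℕ => (m n : ℝ) / (n + 1 : ℕ)) atTop (𝓝 0)) (j : ∀ n, Fin (n + 1)) :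
    ∀ᵐ a ∂P, ∀ s > 0, Tendsto (fun n => Measure.pi (fun _ : Fin n => P)
      {z | s < |spacingAt (m n) (Fin.insertNth (j n) a z : Fin (n + 1) → ℝ) (j n)
        - realDensity P a|}) atTop (𝓝 0) := by
  have : NullSingletonClass P := ⟨fun x => hac (measure_singleton x)⟩
  filter_upwards [hasDerivAt_cdf_ae hac] with a ha s hs
  exact tendsto_measure_abs_spacingAt_sub hm hmn ha.1 ha.2 j hs

lemma tendsto_lintegral_truncated_spacingAt_sub (hac : P ≪ volume) {m : ℕ → ℕ}
    (hm : Tendsto m atTop atTop)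
    (hmn : Tendsto (fun n : ℕ => (m n : ℝ) / (n + 1 : ℕ)) atTop (𝓝 0)) (j : ∀ n, Fin (n + 1))
    {T : ℝ} (hT : 0 < T) :
    Tendsto (fun n => ∫⁻ a, ∫⁻ z, ENNReal.ofReal
      (min |spacingAt (m n) (Fin.insertNth (j n) a z : Fin (n + 1) → ℝ) (j n)
        - realDensity P a| T ^ 2) ∂(Measure.pi fun _ : Fin n => P) ∂P) atTop (𝓝 0) := by
  refine tendsto_lintegral_lintegral_sq_of_tail (b := fun _ => (Set.Iio T).indicator 1)
    (B := fun _ => ENNReal.ofReal T * ENNReal.ofReal T) (fun n a z => by positivity)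
    (fun n => ((measurable_spacingAt_sub (m n) (j n)).abs).min measurable_const)
    (Eventually.of_forall fun n => ae_of_all _ fun a s hs => ?_) (ae_of_all _ fun a => ?_)
    (ae_of_all _ fun a => ENNReal.mul_ne_top ENNReal.ofReal_ne_top ENNReal.ofReal_ne_top) ?_ ?_
  · by_cases hsT : s < T
    · rw [Set.indicator_of_mem (Set.mem_Iio.2 hsT)]
      exact prob_le_one
    · rw [Set.indicator_of_notMem (by simpa using hsT)]
      refine (measure_mono_null (fun z hz => ?_) measure_empty).le
      exact absurd (lt_min_iff.1 (show s < min _ _ from hz)).2 hsT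
  · exact setLIntegral_indicator_Iio_mul_le T
  · simpa using ENNReal.mul_ne_top ENNReal.ofReal_ne_top ENNReal.ofReal_ne_top
  · filter_upwards [tendsto_measure_abs_spacingAt_sub_ae hac hm hmn j] with a ha s hs
    refine tendsto_of_tendsto_of_tendsto_of_le_of_le tendsto_const_nhds (ha s hs)
      (fun _ => zero_le) fun n => measure_mono fun z hz => ?_
    exact (lt_min_iff.1 (show s < min _ _ from hz)).1

lemma tendsto_lintegral_spacingAt_sub (hac : P ≪ volume)
    (hf : ∫⁻ x, ENNReal.ofReal (realDensity P x ^ 2) ∂P < ∞) {m : ℕ → ℕ}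
    (hm : Tendsto m atTop atTop)
    (hmn : Tendsto (fun n : ℕ => (m n : ℝ) / (n + 1 : ℕ)) atTop (𝓝 0)) (j : ∀ n, Fin (n + 1)) :
    Tendsto (fun n => ∫⁻ a, ∫⁻ z, ENNReal.ofReal
      (|spacingAt (m n) (Fin.insertNth (j n) a z : Fin (n + 1) → ℝ) (j n)
        - realDensity P a| ^ 2) ∂(Measure.pi fun _ : Fin n => P) ∂P) atTop (𝓝 0) := by
  have hMtop := hac.ae_le (maximalAverage_lt_top_ae hac)
  have hMm : Measurable fun a => (maximalAverage P a).toReal :=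
    measurable_maximalAverage.ennreal_toReal
  refine tendsto_lintegral_lintegral_sq_of_tail
    (b := fun a s => cubicTail (Real.exp 1 * 8 * (maximalAverage P a).toReal) s
      + (Set.Iio (realDensity P a)).indicator 1 s)
    (B := fun a => ENNReal.ofReal (2 * (Real.exp 1 * 8) ^ 2)
        * ENNReal.ofReal ((maximalAverage P a).toReal ^ 2)
      + ENNReal.ofReal (realDensity P a ^ 2)) (fun n a z => by positivity)
    (fun n => (measurable_spacingAt_sub (m n) (j n)).abs)
    ?_ ?_
    (ae_of_all _ fun a => ENNReal.add_ne_top.2 ⟨ENNReal.mul_ne_top ENNReal.ofReal_ne_top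
      ENNReal.ofReal_ne_top, ENNReal.ofReal_ne_top⟩) ?_
    (tendsto_measure_abs_spacingAt_sub_ae hac hm hmn j)
  · filter_upwards [hm.eventually_ge_atTop 3,
      hmn.eventually_lt_const (show (0 : ℝ) < 1 / 2 by norm_num)] with n hn3 hn
    have h2 : 2 * m n ≤ n + 1 := by
      rw [div_lt_iff₀ (by positivity)] at hn
      have : (2 * m n : ℝ) < (n + 1 : ℕ) := by linarith
      exact_mod_cast this.le
    filter_upwards [hMtop] with a ha s hs
    refine le_trans (measure_mono (t := {z | s < spacingAt (m n)
      (Fin.insertNth (j n) a z : Fin (n + 1) → ℝ) (j n)} ∪ {z | s < realDensity P a})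
        -- Both quantities are nonnegative, so a difference exceeding `s` in absolute value forces
        -- one of them to exceed `s`.
        fun z hz => ?_) ((measure_union_le _ _).trans (add_le_add ?_ ?_))
    · have hz' : s < |_| := hz
      have h0 := spacingAt_nonneg (m n) (Fin.insertNth (j n) a z : Fin (n + 1) → ℝ) (j n)
      have h1 := realDensity_nonneg P a
      rcases lt_abs.1 hz' with h | h
      · exact Or.inl (show s < _ by linarith)
      · exact Or.inr (show s < _ by linarith)
    · exact measure_lt_spacingAt_le hn3 h2 (j n) (maximalAverage_toReal_pos ha)
        (fun d hd => measureReal_closedBall_le_maximalAverage ha hd) hs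
    · by_cases hsf : s < realDensity P a
      · rw [Set.indicator_of_mem (Set.mem_Iio.2 hsf)]
        exact prob_le_one
      · simp [hsf]
  · filter_upwards [hMtop] with a ha
    simp_rw [add_mul]
    rw [lintegral_add_right _ (by
      exact (measurable_one.indicator measurableSet_Iio).mul ENNReal.measurable_ofReal)]
    refine add_le_add ((lintegral_cubicTail_le ?_).trans_eq ?_) ?_
    · have := maximalAverage_toReal_pos ha
      positivity
    · rw [← ENNReal.ofReal_mul (by positivity)]
      congr 1
      ring
    · rw [sq, ENNReal.ofReal_mul (realDensity_nonneg P a)]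
      exact setLIntegral_indicator_Iio_mul_le _
  · rw [lintegral_add_left ((hMm.pow_const 2).ennreal_ofReal.const_mul _),
      lintegral_const_mul' _ _ ENNReal.ofReal_ne_top]
    exact ENNReal.add_ne_top.2 ⟨ENNReal.mul_ne_top ENNReal.ofReal_ne_top
      (lintegral_maximalAverage_sq_lt_top hac hf).ne, hf.ne⟩

/-- Fubini: the `j`-th coordinate becomes the fixed point `a`, the others form an independent sample
of size `n`. -/
lemma lintegral_average_spacingAt_sub_eq {n : ℕ} (m : ℕ) {G : ℝ → ℝ} (hG : Measurable G) :
    ∫⁻ x, ENNReal.ofReal (1 / (n + 1 : ℕ) * ∑ j, G (spacingAt m x j - realDensity P (x j)) ^ 2)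
      ∂(Measure.pi fun _ : Fin (n + 1) => P)
    = ENNReal.ofReal (1 / (n + 1 : ℕ)) * ∑ j : Fin (n + 1), ∫⁻ a, ∫⁻ z, ENNReal.ofReal
      (G (spacingAt m (Fin.insertNth j a z : Fin (n + 1) → ℝ) j - realDensity P a) ^ 2)
        ∂(Measure.pi fun _ : Fin n => P) ∂P := by
  have hmeas (j : Fin (n + 1)) : Measurable fun x : Fin (n + 1) → ℝ =>
      ENNReal.ofReal (G (spacingAt m x j - realDensity P (x j)) ^ 2) :=
    ((hG.comp ((measurable_spacingAt m j).sub
      ((measurable_realDensity P).comp (measurable_pi_apply j)))).pow_const 2).ennreal_ofReal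
  calc _ = ∫⁻ x, ENNReal.ofReal (1 / (n + 1 : ℕ)) * ∑ j, ENNReal.ofReal
        (G (spacingAt m x j - realDensity P (x j)) ^ 2) ∂(Measure.pi fun _ : Fin (n + 1) => P) := by
        refine lintegral_congr fun x => ?_
        rw [ENNReal.ofReal_mul (by positivity), ENNReal.ofReal_sum_of_nonneg]
        intro j _
        positivity
    _ = ENNReal.ofReal (1 / (n + 1 : ℕ)) * ∑ j, ∫⁻ x, ENNReal.ofReal
        (G (spacingAt m x j - realDensity P (x j)) ^ 2) ∂(Measure.pi fun _ : Fin (n + 1) => P) := by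
        rw [lintegral_const_mul' _ _ ENNReal.ofReal_ne_top,
          lintegral_finsetSum _ fun j _ => hmeas j]
    _ = _ := by
        congr 1
        refine Finset.sum_congr rfl fun j _ => ?_
        have hmp := (measurePreserving_piFinSuccAbove (fun _ : Fin (n + 1) => P) j).symm
        rw [← hmp.lintegral_comp (hmeas j), lintegral_prod]
        · refine lintegral_congr fun a => lintegral_congr fun z => ?_
          simp [MeasurableEquiv.piFinSuccAbove, Fin.insertNthEquiv]
        · exact ((hmeas j).comp hmp.measurable).aemeasurable

/-- The average over `j` is at most its largest term. Selecting a maximising index for each `n`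
replaces uniformity in `j` by the hypothesis for every sequence of indices. -/
lemma tendsto_lintegral_average_of_forall {m : ℕ → ℕ} {G : ℝ → ℝ} (hG : Measurable G)
    (h : ∀ j : ∀ n, Fin (n + 1), Tendsto (fun n => ∫⁻ a, ∫⁻ z, ENNReal.ofReal
      (G (spacingAt (m n) (Fin.insertNth (j n) a z : Fin (n + 1) → ℝ) (j n)
        - realDensity P a) ^ 2) ∂(Measure.pi fun _ : Fin n => P) ∂P) atTop (𝓝 0)) :
    Tendsto (fun n => ∫⁻ x, ENNReal.ofReal
      (1 / (n + 1 : ℕ) * ∑ j, G (spacingAt (m n) x j - realDensity P (x j)) ^ 2)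
      ∂(Measure.pi fun _ : Fin (n + 1) => P)) atTop (𝓝 0) := by
  set e : ∀ n : ℕ, Fin (n + 1) → ℝ≥0∞ := fun n j => ∫⁻ a, ∫⁻ z, ENNReal.ofReal
      (G (spacingAt (m n) (Fin.insertNth j a z : Fin (n + 1) → ℝ) j
        - realDensity P a) ^ 2) ∂(Measure.pi fun _ : Fin n => P) ∂P with he
  choose j hj using fun n => Finite.exists_max (e n)
  refine tendsto_of_tendsto_of_tendsto_of_le_of_le tendsto_const_nhds (h j)
    (fun _ => zero_le) fun n => ?_
  simp only [lintegral_average_spacingAt_sub_eq (m n) hG]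
  calc ENNReal.ofReal (1 / (n + 1 : ℕ)) * ∑ i, e n i
      ≤ ENNReal.ofReal (1 / (n + 1 : ℕ)) * ∑ _i : Fin (n + 1), e n (j n) := by
        gcongr with i
        exact hj n i
    _ = e n (j n) := by
        rw [Finset.sum_const, Finset.card_univ, Fintype.card_fin, nsmul_eq_mul, ← mul_assoc,
          ← ENNReal.ofReal_natCast (n + 1), ← ENNReal.ofReal_mul (by positivity),
          one_div_mul_cancel (by positivity), ENNReal.ofReal_one, one_mul]

end SecondMoment

/-! ### Deterministic comparison of empirical variances. -/

section SampleVariance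

/-- The variance of the empirical distribution of `r`. -/
noncomputable def sampleVariance {n : ℕ} (r : Fin n → ℝ) : ℝ :=
  1 / (n : ℝ) * ∑ i, r i ^ 2 - (1 / (n : ℝ) * ∑ i, r i) ^ 2

lemma varextropyEstimator_eq_sampleVariance {n : ℕ} (m : ℕ) (x : Fin n → ℝ) :
    varextropyEstimator m x = 1 / 4 * sampleVariance (spacingAt m x) := by
  have h1 : ∑ j, spacingAt m x j ^ 2 = ∑ i, spacingRatio m x i ^ 2 :=
    Equiv.sum_comp (Tuple.sort x).symm fun i => spacingRatio m x i ^ 2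
  have h2 : ∑ j, spacingAt m x j = ∑ i, spacingRatio m x i :=
    Equiv.sum_comp (Tuple.sort x).symm fun i => spacingRatio m x i
  rw [varextropyEstimator, sampleVariance, h1, h2]
  rcases eq_or_ne (n : ℝ) 0 with h | h
  · simp [h]
  · field_simp

/-- In terms of pairwise differences, the effect of a Lipschitz map or a perturbation can be read
off termwise. -/
lemma sampleVariance_eq_sum_sum {n : ℕ} (r : Fin (n + 1) → ℝ) :
    sampleVariance r = 1 / (2 * ((n + 1 : ℕ) : ℝ) ^ 2) * ∑ i, ∑ j, (r i - r j) ^ 2 := by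
  have h : ∑ i, ∑ j, (r i - r j) ^ 2
      = 2 * ((n + 1 : ℕ) : ℝ) * ∑ i, r i ^ 2 - 2 * (∑ i, r i) ^ 2 := by
    simp_rw [sub_sq, Finset.sum_add_distrib, Finset.sum_sub_distrib, ← Finset.mul_sum,
      ← Finset.sum_mul, Finset.sum_const, Finset.card_univ, Fintype.card_fin, nsmul_eq_mul,
      ← Finset.mul_sum]
    ring
  have hn : ((n + 1 : ℕ) : ℝ) ≠ 0 := by positivity
  rw [h, sampleVariance]
  field_simp

lemma sampleVariance_le_average_sq {n : ℕ} (r : Fin n → ℝ) :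
    sampleVariance r ≤ 1 / (n : ℝ) * ∑ i, r i ^ 2 :=
  sub_le_self _ (sq_nonneg _)

/-- Truncation is 1-Lipschitz, so it shrinks every pairwise difference. -/
lemma sampleVariance_min_le {n : ℕ} (r : Fin (n + 1) → ℝ) (T : ℝ) :
    sampleVariance (fun i => min (r i) T) ≤ sampleVariance r := by
  rw [sampleVariance_eq_sum_sum, sampleVariance_eq_sum_sum]
  refine mul_le_mul_of_nonneg_left (Finset.sum_le_sum fun i _ => Finset.sum_le_sum fun j _ => ?_)
    (by positivity)
  exact sq_le_sq.2 (by simpa using abs_min_sub_min_le_max (r i) T (r j) T)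

/-- Young's inequality applied to `x^2 - y^2 = (x - y)^2 + 2 y (x - y)` for each pairwise
difference. -/
lemma abs_sampleVariance_sub_le {n : ℕ} (r f : Fin (n + 1) → ℝ) {η : ℝ} (hη : 0 < η) :
    |sampleVariance r - sampleVariance f| ≤ η * sampleVariance f
      + (1 + 1 / η) * (1 / ((n + 1 : ℕ) : ℝ) * ∑ i, (r i - f i) ^ 2) := by
  have hpt (x y : ℝ) : |x ^ 2 - y ^ 2| ≤ η * y ^ 2 + (1 + 1 / η) * (x - y) ^ 2 := by
    have h1 : 0 ≤ (η * y - (x - y)) ^ 2 / η := by positivity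
    have h2 : 0 ≤ (η * y + (x - y)) ^ 2 / η := by positivity
    have e1 : (η * y - (x - y)) ^ 2 / η = η * y ^ 2 + 1 / η * (x - y) ^ 2 - 2 * y * (x - y) := by
      field_simp
      ring
    have e2 : (η * y + (x - y)) ^ 2 / η = η * y ^ 2 + 1 / η * (x - y) ^ 2 + 2 * y * (x - y) := by
      field_simp
      ring
    rw [abs_le]
    constructor <;> nlinarith [sq_nonneg (x - y)]
  set c : ℝ := 1 / (2 * ((n + 1 : ℕ) : ℝ) ^ 2) with hc
  have hc0 : 0 ≤ c := by positivity
  have hdiff := sampleVariance_le_average_sq fun i => r i - f i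
  calc |sampleVariance r - sampleVariance f|
      = |c * ∑ i, ∑ j, ((r i - r j) ^ 2 - (f i - f j) ^ 2)| := by
        rw [sampleVariance_eq_sum_sum, sampleVariance_eq_sum_sum, ← mul_sub, ← hc]
        simp_rw [← Finset.sum_sub_distrib]
    _ ≤ c * ∑ i, ∑ j, |(r i - r j) ^ 2 - (f i - f j) ^ 2| := by
        rw [abs_mul, abs_of_nonneg hc0]
        gcongr
        exact (Finset.abs_sum_le_sum_abs _ _).trans
          (Finset.sum_le_sum fun i _ => Finset.abs_sum_le_sum_abs _ _)
    _ ≤ c * ∑ i, ∑ j, (η * (f i - f j) ^ 2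
          + (1 + 1 / η) * ((r i - f i) - (r j - f j)) ^ 2) := by
        gcongr with i _ j _
        refine (hpt _ _).trans_eq ?_
        ring
    _ = η * sampleVariance f + (1 + 1 / η) * sampleVariance fun i => r i - f i := by
        rw [sampleVariance_eq_sum_sum, sampleVariance_eq_sum_sum]
        simp_rw [Finset.sum_add_distrib, ← Finset.mul_sum]
        ring
    _ ≤ _ := by gcongr

end SampleVariance

/-! ### Truncated variances of a variable that is not square integrable. -/

section Truncation

variable {Ω : Type*} [MeasurableSpace Ω] {μ : Measure Ω} [IsProbabilityMeasure μ] {Y : Ω → ℝ}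

lemma memLp_min_const (hY : AEMeasurable Y μ) (hY0 : ∀ ω, 0 ≤ Y ω) {T : ℝ} (hT : 0 ≤ T) :
    MemLp (fun ω => min (Y ω) T) 2 μ :=
  MemLp.of_bound (hY.min aemeasurable_const).aestronglyMeasurable T
    (ae_of_all _ fun ω => by
      rw [Real.norm_of_nonneg (le_min (hY0 ω) hT)]
      exact min_le_right _ _)

lemma exists_half_le_measure_le (μ : Measure Ω) [IsProbabilityMeasure μ] (Y : Ω → ℝ) :
    ∃ c : ℝ, 0 ≤ c ∧ ENNReal.ofReal (1 / 2) ≤ μ {ω | Y ω ≤ c} := by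
  have hmono : Monotone fun k : ℕ => {ω | Y ω ≤ k} := fun k l hkl ω hω =>
    (show Y ω ≤ k from hω).trans (by exact_mod_cast hkl)
  have hU : ⋃ k : ℕ, {ω | Y ω ≤ k} = Set.univ := by
    refine Set.eq_univ_of_forall fun ω => ?_
    obtain ⟨k, hk⟩ := exists_nat_ge (Y ω)
    exact Set.mem_iUnion.2 ⟨k, hk⟩
  have h := tendsto_measure_iUnion_atTop (μ := μ) hmono
  rw [hU, measure_univ] at h
  have hlt : ENNReal.ofReal (1 / 2) < 1 := by
    rw [ENNReal.ofReal_lt_one]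
    norm_num
  obtain ⟨k, hk⟩ := (h.eventually_const_lt hlt).exists
  exact ⟨k, k.cast_nonneg, hk.le⟩

/-- If all truncated variances stayed below `C`, Chebyshev would bound the truncated means, since
half of the mass lies below a fixed `c`. Second moments would then be bounded too, and Fatou would
put `Y` in `L²`. -/
lemma exists_le_variance_min (hY : AEMeasurable Y μ) (hY0 : ∀ ω, 0 ≤ Y ω) (h : ¬ MemLp Y 2 μ)
    (C : ℝ) : ∃ T > 0, C ≤ Var[fun ω => min (Y ω) T; μ] := by
  by_contra hcon
  push Not at hcon
  have hC : 0 < C := (variance_nonneg _ _).trans_lt (hcon 1 one_pos)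
  obtain ⟨c, hc0, hc⟩ := exists_half_le_measure_le μ Y
  -- With `w^2 = 2 C`, the Chebyshev bound is strictly below `1/2`.
  set w : ℝ := √(2 * C) with hw
  have hw0 : 0 < w := by positivity
  have hw2 : w ^ 2 = 2 * C := Real.sq_sqrt (by positivity)
  have hmean (T : ℝ) (hT : 0 < T) : ∫ ω, min (Y ω) T ∂μ ≤ c + w := by
    by_contra hlt
    push Not at hlt
    have hch := meas_ge_le_variance_div_sq (memLp_min_const hY hY0 hT.le) hw0
    have hsub : {ω | Y ω ≤ c} ⊆ {ω | w ≤ |min (Y ω) T - ∫ ω, min (Y ω) T ∂μ|} := by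
      intro ω hω
      have h1 : min (Y ω) T ≤ c := (min_le_left _ _).trans hω
      rw [Set.mem_ofPred_eq, abs_sub_comm]
      exact le_trans (by linarith) (le_abs_self _)
    have h2 := hc.trans ((measure_mono hsub).trans hch)
    have h3 : Var[fun ω => min (Y ω) T; μ] / w ^ 2 < 1 / 2 := by
      rw [hw2, div_lt_iff₀ (by positivity)]
      linarith [hcon T hT]
    exact absurd h2 (not_le.2 ((ENNReal.ofReal_lt_ofReal_iff (by norm_num)).2 h3))
  have hsq (T : ℝ) (hT : 0 < T) :
      ∫⁻ ω, ENNReal.ofReal (min (Y ω) T ^ 2) ∂μ ≤ ENNReal.ofReal (C + (c + w) ^ 2) := by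
    have hL := memLp_min_const hY hY0 hT.le
    rw [← ofReal_integral_eq_lintegral_ofReal hL.integrable_sq (ae_of_all _ fun _ => sq_nonneg _)]
    refine ENNReal.ofReal_le_ofReal ?_
    have hv := variance_eq_sub hL
    have h0 : 0 ≤ ∫ ω, min (Y ω) T ∂μ := integral_nonneg fun ω => le_min (hY0 ω) hT.le
    have h1 := pow_le_pow_left₀ h0 (hmean T hT) 2
    have h2 := hcon T hT
    simp only [Pi.pow_apply] at hv
    linarith
  have hfatou : ∫⁻ ω, ENNReal.ofReal (Y ω ^ 2) ∂μ ≤ ENNReal.ofReal (C + (c + w) ^ 2) := by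
    calc ∫⁻ ω, ENNReal.ofReal (Y ω ^ 2) ∂μ
        = ∫⁻ ω, liminf (fun k : ℕ => ENNReal.ofReal (min (Y ω) (k + 1) ^ 2)) atTop ∂μ := by
          refine lintegral_congr fun ω => (Tendsto.liminf_eq ?_).symm
          refine tendsto_const_nhds.congr' ?_
          obtain ⟨N, hN⟩ := exists_nat_ge (Y ω)
          filter_upwards [eventually_ge_atTop N] with k hk
          have : (N : ℝ) ≤ k := by exact_mod_cast hk
          rw [min_eq_left (by linarith)]
      _ ≤ liminf (fun k : ℕ => ∫⁻ ω, ENNReal.ofReal (min (Y ω) (k + 1) ^ 2) ∂μ) atTop :=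
          lintegral_liminf_le' fun k => ((hY.min aemeasurable_const).pow_const 2).ennreal_ofReal
      _ ≤ liminf (fun _ : ℕ => ENNReal.ofReal (C + (c + w) ^ 2)) atTop :=
          liminf_le_liminf (Eventually.of_forall fun k => hsq _ (by positivity))
      _ = _ := by simp
  refine h ((memLp_two_iff_integrable_sq hY.aestronglyMeasurable).2
    ⟨(hY.pow_const 2).aestronglyMeasurable, ?_⟩)
  rw [hasFiniteIntegral_iff_ofReal (ae_of_all _ fun _ => sq_nonneg _)]
  exact hfatou.trans_lt ENNReal.ofReal_lt_top

end Truncation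

/-! ### Limits in probability for the random sample. -/

section Sample

variable {Ω : Type*} [MeasurableSpace Ω] {μ : Measure Ω} [IsProbabilityMeasure μ] {X : ℕ → Ω → ℝ}

lemma map_sample_eq_pi (hindep : iIndepFun X μ) (hident : ∀ i, IdentDistrib (X i) (X 0) μ μ)
    (n : ℕ) :
    μ.map (fun ω (i : Fin n) => X i ω) = Measure.pi fun _ : Fin n => μ.map (X 0) := by
  have h := (iIndepFun_iff_map_fun_eq_pi_map (f := fun i : Fin n => X i)
    fun i => (hident i).aemeasurable_fst).1 (hindep.precomp Fin.val_injective)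
  rw [h]
  congr 1
  ext1 i
  exact (hident i).map_eq

lemma tendsto_measure_le_average (hindep : iIndepFun X μ)
    (hident : ∀ i, IdentDistrib (X i) (X 0) μ μ) {D : ∀ n, (Fin (n + 1) → ℝ) → ℝ}
    (hD : ∀ n, Measurable (D n))
    (h : Tendsto (fun n => ∫⁻ x, ENNReal.ofReal (D n x)
      ∂(Measure.pi fun _ : Fin (n + 1) => μ.map (X 0))) atTop (𝓝 0)) {δ : ℝ} (hδ : 0 < δ) :
    Tendsto (fun n => μ {ω | δ ≤ D n fun i => X i ω}) atTop (𝓝 0) := by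
  have hδ' : ENNReal.ofReal δ ≠ 0 := by simpa using hδ
  have hlim := ENNReal.Tendsto.div_const h (Or.inr hδ') (b := ENNReal.ofReal δ)
  rw [ENNReal.zero_div] at hlim
  refine tendsto_of_tendsto_of_tendsto_of_le_of_le tendsto_const_nhds hlim
    (fun _ => zero_le) fun n => ?_
  have hm : AEMeasurable (fun ω (i : Fin (n + 1)) => X i ω) μ :=
    aemeasurable_pi_lambda _ fun i => (hident i).aemeasurable_fst
  have hmk := meas_ge_le_lintegral_div
    (μ := Measure.pi fun _ : Fin (n + 1) => μ.map (X 0))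
    (hD n).ennreal_ofReal.aemeasurable hδ' ENNReal.ofReal_ne_top
  refine le_trans ?_ hmk
  rw [← map_sample_eq_pi hindep hident, Measure.map_apply_of_aemeasurable hm
    (measurableSet_le measurable_const (hD n).ennreal_ofReal)]
  exact measure_mono fun ω hω => ENNReal.ofReal_le_ofReal hω

lemma measurable_average_spacingAt_sub {P : Measure ℝ} {n : ℕ} (m : ℕ) {G : ℝ → ℝ}
    (hG : Measurable G) :
    Measurable fun x : Fin (n + 1) → ℝ =>
      1 / (n + 1 : ℕ) * ∑ j, G (spacingAt m x j - realDensity P (x j)) ^ 2 :=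
  (Finset.measurable_sum _ fun j _ => (hG.comp ((measurable_spacingAt m j).sub
    ((measurable_realDensity P).comp (measurable_pi_apply j)))).pow_const 2).const_mul _

/-- The strong law for `g(X_i)` and `g(X_i)^2`; almost sure convergence implies convergence in
measure. -/
lemma tendsto_measure_le_abs_sampleVariance_sub (hindep : iIndepFun X μ)
    (hident : ∀ i, IdentDistrib (X i) (X 0) μ μ) {g : ℝ → ℝ} (hg : Measurable g)
    (hL : MemLp (fun ω => g (X 0 ω)) 2 μ) {ε : ℝ} (hε : 0 < ε) :
    Tendsto (fun n : ℕ => μ {ω | ε ≤ |sampleVariance (fun i : Fin (n + 1) => g (X i ω))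
      - Var[fun ω => g (X 0 ω); μ]|}) atTop (𝓝 0) := by
  have hlln (k : ℝ → ℝ) (hk : Measurable k) (hint : Integrable (fun ω => k (X 0 ω)) μ) :
      ∀ᵐ ω ∂μ, Tendsto (fun n : ℕ => (∑ i ∈ Finset.range n, k (X i ω)) / n) atTop
        (𝓝 (∫ ω, k (X 0 ω) ∂μ)) :=
    strong_law_ae_real (fun i ω => k (X i ω)) hint
      (fun i j hij => (hindep.indepFun hij).comp hk hk) fun i => (hident i).comp hk
  have hae : ∀ᵐ ω ∂μ, Tendsto (fun n : ℕ => sampleVariance (fun i : Fin (n + 1) => g (X i ω)))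
      atTop (𝓝 Var[fun ω => g (X 0 ω); μ]) := by
    filter_upwards [hlln g hg (hL.integrable (by norm_num)),
      hlln (fun x => g x ^ 2) (hg.pow_const 2) hL.integrable_sq] with ω h1 h2
    rw [variance_eq_sub hL]
    have := (tendsto_add_atTop_iff_nat 1).2 (h2.sub (h1.pow 2))
    refine this.congr fun n => ?_
    rw [sampleVariance, Fin.sum_univ_eq_sum_range (fun i => g (X i ω)),
      Fin.sum_univ_eq_sum_range (fun i => g (X i ω) ^ 2)]
    ring
  have hmeas (n : ℕ) : AEStronglyMeasurable
      (fun ω => sampleVariance (fun i : Fin (n + 1) => g (X i ω))) μ := by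
    have hgX (i : ℕ) : AEMeasurable (fun ω => g (X i ω)) μ :=
      hg.comp_aemeasurable (hident i).aemeasurable_fst
    have hsum : AEMeasurable (fun ω => ∑ i : Fin (n + 1), g (X i ω)) μ :=
      Finset.aemeasurable_fun_sum _ fun i _ => hgX i
    have hsum2 : AEMeasurable (fun ω => ∑ i : Fin (n + 1), g (X i ω) ^ 2) μ :=
      Finset.aemeasurable_fun_sum _ fun i _ => (hgX i).pow_const 2
    exact ((hsum2.const_mul _).sub ((hsum.const_mul _).pow_const 2)).aestronglyMeasurable
  exact (tendstoInMeasure_iff_norm.1 (tendstoInMeasure_of_tendsto_ae hmeas hae)) ε hε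

lemma tendstoInMeasure_varextropyEstimator (hindep : iIndepFun X μ)
    (hident : ∀ i, IdentDistrib (X i) (X 0) μ μ) (hac : μ.map (X 0) ≪ volume)
    [IsProbabilityMeasure (μ.map (X 0))]
    (hL : MemLp (fun ω => realDensity (μ.map (X 0)) (X 0 ω)) 2 μ) {m : ℕ → ℕ}
    (hm : Tendsto m atTop atTop)
    (hmn : Tendsto (fun n : ℕ => (m n : ℝ) / (n + 1 : ℕ)) atTop (𝓝 0)) :
    TendstoInMeasure μ
      (fun n ω => varextropyEstimator (m n) (fun i : Fin (n + 1) => X i ω)) atTop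
      (fun _ => 1 / 4 * Var[fun ω => realDensity (μ.map (X 0)) (X 0 ω); μ]) := by
  set P := μ.map (X 0) with hP
  set f := realDensity P with hf
  have hX0 := (hident 0).aemeasurable_fst
  have hfin : ∫⁻ x, ENNReal.ofReal (f x ^ 2) ∂P < ∞ := by
    rw [hP, lintegral_map' ((measurable_realDensity P).pow_const 2).ennreal_ofReal.aemeasurable hX0]
    exact hL.integrable_sq.lintegral_lt_top
  have hD0 := tendsto_lintegral_average_of_forall (P := P) (m := m) (G := fun y => |y|)
    measurable_norm fun j => tendsto_lintegral_spacingAt_sub hac hfin hm hmn j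
  set v := Var[fun ω => f (X 0 ω); μ] with hv
  have hv0 : 0 ≤ v := variance_nonneg _ _
  rw [tendstoInMeasure_iff_norm]
  intro ε hε
  -- Here `η` and `δ` are tuned so that both terms of the variance comparison are at most `ε`. With
  -- the error from the law of large numbers the total is below `3 ε`, while the factor `1/4` of the
  -- estimator allows `4 ε`.
  set η : ℝ := ε / (v + ε) with hη
  have hη0 : 0 < η := by positivity
  have hηv : η * (v + ε) = ε := div_mul_cancel₀ _ (by positivity)
  set δ : ℝ := ε / (1 + 1 / η) with hδ
  have hδ0 : 0 < δ := by positivity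
  have hηδ : (1 + 1 / η) * δ = ε := mul_div_cancel₀ _ (by positivity)
  have h1 := tendsto_measure_le_average hindep hident
    (fun n => measurable_average_spacingAt_sub (P := P) (m n) measurable_norm) hD0 hδ0
  have h2 := tendsto_measure_le_abs_sampleVariance_sub hindep hident
    (measurable_realDensity P) hL hε
  have h12 := h1.add h2
  rw [add_zero] at h12
  refine tendsto_of_tendsto_of_tendsto_of_le_of_le tendsto_const_nhds h12
    (fun _ => zero_le) fun n => le_trans (measure_mono fun ω hω => ?_) (measure_union_le _ _)
  by_contra hcon
  simp only [Set.mem_union, Set.mem_ofPred_eq, not_or, not_le] at hcon hω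
  obtain ⟨c1, c2⟩ := hcon
  rw [varextropyEstimator_eq_sampleVariance, ← mul_sub, norm_mul] at hω
  norm_num [Real.norm_eq_abs] at hω
  have hcmp := abs_sampleVariance_sub_le (spacingAt (m n) fun i : Fin (n + 1) => X i ω)
    (fun i => f (X i ω)) hη0
  simp only [Real.norm_eq_abs, sq_abs] at c1
  have e1 := mul_lt_mul_of_pos_left c1 (show 0 < 1 + 1 / η by positivity)
  rw [hηδ] at e1
  have hVf : sampleVariance (fun i : Fin (n + 1) => f (X i ω)) ≤ v + ε := by
    linarith [(abs_lt.1 c2).2]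
  have e2 := mul_le_mul_of_nonneg_left hVf hη0.le
  rw [hηv] at e2
  have e3 := abs_sub_le (sampleVariance (spacingAt (m n) fun i : Fin (n + 1) => X i ω))
    (sampleVariance fun i : Fin (n + 1) => f (X i ω)) v
  linarith

lemma tendsto_measure_varextropyEstimator_le (hindep : iIndepFun X μ)
    (hident : ∀ i, IdentDistrib (X i) (X 0) μ μ) (hac : μ.map (X 0) ≪ volume)
    [IsProbabilityMeasure (μ.map (X 0))]
    (hL : ¬ MemLp (fun ω => realDensity (μ.map (X 0)) (X 0 ω)) 2 μ) {m : ℕ → ℕ}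
    (hm : Tendsto m atTop atTop)
    (hmn : Tendsto (fun n : ℕ => (m n : ℝ) / (n + 1 : ℕ)) atTop (𝓝 0)) (K : ℝ) :
    Tendsto (fun n => μ {ω | varextropyEstimator (m n) (fun i : Fin (n + 1) => X i ω) ≤ K})
      atTop (𝓝 0) := by
  set P := μ.map (X 0) with hP
  set f := realDensity P with hf
  have hfX : AEMeasurable (fun ω => f (X 0 ω)) μ :=
    (measurable_realDensity P).comp_aemeasurable (hident 0).aemeasurable_fst
  -- The empirical truncated variance of the density exceeds `8 K + 6` off a small event. Comparison
  -- with `η = 1/2` keeps half of it and loses at most `3`, leaving more than `4 K`.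
  obtain ⟨T, hT, hTv⟩ := exists_le_variance_min hfX (fun ω => realDensity_nonneg P _) hL
    (8 * K + 7)
  have hGm : Measurable fun y : ℝ => min |y| T := measurable_norm.min measurable_const
  have hD0 := tendsto_lintegral_average_of_forall (P := P) (m := m) hGm
    fun j => tendsto_lintegral_truncated_spacingAt_sub hac hm hmn j hT
  have h1 := tendsto_measure_le_average hindep hident
    (fun n => measurable_average_spacingAt_sub (P := P) (m n) hGm) hD0 one_pos
  have h2 := tendsto_measure_le_abs_sampleVariance_sub hindep hident
    (g := fun x => min (f x) T) ((measurable_realDensity P).min measurable_const)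
    (memLp_min_const hfX (fun ω => realDensity_nonneg P _) hT.le) one_pos
  have h12 := h1.add h2
  rw [add_zero] at h12
  refine tendsto_of_tendsto_of_tendsto_of_le_of_le tendsto_const_nhds h12
    (fun _ => zero_le) fun n => le_trans (measure_mono fun ω hω => ?_) (measure_union_le _ _)
  by_contra hcon
  simp only [Set.mem_union, Set.mem_ofPred_eq, not_or, not_le] at hcon hω
  obtain ⟨c1, c2⟩ := hcon
  rw [varextropyEstimator_eq_sampleVariance] at hω
  set r := spacingAt (m n) fun i : Fin (n + 1) => X i ω with hr
  have hcmp := abs_sampleVariance_sub_le (fun i => min (r i) T)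
    (fun i : Fin (n + 1) => min (f (X i ω)) T) (η := 1 / 2) (by norm_num)
  have hmin := sampleVariance_min_le r T
  have hD : 1 / ((n + 1 : ℕ) : ℝ) * ∑ i, (min (r i) T - min (f (X i ω)) T) ^ 2
      ≤ 1 / ((n + 1 : ℕ) : ℝ) * ∑ i, min |r i - f (X i ω)| T ^ 2 := by
    refine mul_le_mul_of_nonneg_left (Finset.sum_le_sum fun i _ => ?_) (by positivity)
    rw [← sq_abs (_ - _)]
    have hr0 : 0 ≤ r i := spacingAt_nonneg _ _ _
    have hf0 : 0 ≤ f (X i ω) := realDensity_nonneg P _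
    -- Truncated values differ by at most the original difference, and by at most `T` since both lie
    -- in `[0, T]`.
    refine pow_le_pow_left₀ (abs_nonneg _) (le_min ?_ ?_) 2
    · simpa using abs_min_sub_min_le_max (r i) T (f (X i ω)) T
    · have a1 := le_min hr0 hT.le
      have a2 := le_min hf0 hT.le
      have a3 := min_le_right (r i) T
      have a4 := min_le_right (f (X i ω)) T
      exact abs_le.2 ⟨by linarith, by linarith⟩
  have b1 := (abs_le.1 hcmp).1
  have b2 := (abs_lt.1 c2).1
  norm_num at b1
  norm_num at c1 hD
  linarith

end Sample

theorem theorem2 {Ω : Type*} [MeasurableSpace Ω] (μ : Measure Ω) [IsProbabilityMeasure μ]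
    (X : ℕ → Ω → ℝ)
    (hindep : iIndepFun X μ)
    (hident : ∀ i, IdentDistrib (X i) (X 0) μ μ)
    (hpdf : HasPDF (X 0) μ volume)
    (m : ℕ → ℕ)
    (hm : Tendsto m atTop atTop)
    (hmn : Tendsto (fun n : ℕ => (m n : ℝ) / (n : ℝ)) atTop (𝓝 0)) :
    (varextropy (X 0) μ ≠ ∞ →
      TendstoInMeasure μ
        (fun (n : ℕ) (ω : Ω) => varextropyEstimator (m n) (fun i : Fin n => X i ω))
        atTop (fun _ => (varextropy (X 0) μ).toReal)) ∧
    (varextropy (X 0) μ = ∞ →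
      ∀ K : ℝ, Tendsto
        (fun n : ℕ => μ {ω | varextropyEstimator (m n) (fun i : Fin n => X i ω) ≤ K})
        atTop (𝓝 0)) := by
  have hX0 : AEMeasurable (X 0) μ := (hident 0).aemeasurable_fst
  have : IsProbabilityMeasure (μ.map (X 0)) := Measure.isProbabilityMeasure_map hX0
  have hac : μ.map (X 0) ≪ volume := hpdf.absolutelyContinuous
  have hY : AEStronglyMeasurable (fun ω => realDensity (μ.map (X 0)) (X 0 ω)) μ :=
    ((measurable_realDensity _).comp_aemeasurable hX0).aestronglyMeasurable
  have hvar : varextropy (X 0) μ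
      = ENNReal.ofReal (1 / 4) * eVar[fun ω => realDensity (μ.map (X 0)) (X 0 ω); μ] := by
    have := evariance_mul (-(1 / 2 : ℝ)) (fun ω => realDensity (μ.map (X 0)) (X 0 ω)) μ
    rw [show (-(1 / 2 : ℝ)) ^ 2 = 1 / 4 by norm_num] at this
    rw [← this, varextropy, pdf_def]
    rfl
  -- Infinite variance is failure of square integrability, which separates the two cases.
  have htop : varextropy (X 0) μ = ∞ ↔
      ¬ MemLp (fun ω => realDensity (μ.map (X 0)) (X 0 ω)) 2 μ := by
    rw [← evariance_eq_top_iff hY, hvar, ENNReal.mul_eq_top]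
    norm_num
  -- Shifting `n` by one discards the empty sample and matches the sample size `n + 1` used above.
  have hm' : Tendsto (fun n => m (n + 1)) atTop atTop := hm.comp (tendsto_add_atTop_nat 1)
  have hmn' : Tendsto (fun n : ℕ => (m (n + 1) : ℝ) / (n + 1 : ℕ)) atTop (𝓝 0) :=
    hmn.comp (tendsto_add_atTop_nat 1)
  refine ⟨fun hfin => ?_, fun hinf K => ?_⟩
  · have hval : (varextropy (X 0) μ).toReal
        = 1 / 4 * Var[fun ω => realDensity (μ.map (X 0)) (X 0 ω); μ] := by
      rw [hvar, ENNReal.toReal_mul, ENNReal.toReal_ofReal (by norm_num)]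
      rfl
    rw [hval]
    intro ε hε
    exact (tendsto_add_atTop_iff_nat 1).1 (tendstoInMeasure_varextropyEstimator hindep hident hac
      (not_not.1 (htop.not.1 hfin)) hm' hmn' ε hε)
  · exact (tendsto_add_atTop_iff_nat 1).1 (tendsto_measure_varextropyEstimator_le hindep hident hac
      (htop.1 hinf) hm' hmn' K)
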